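/- Let $A\ge 0$ and $\sigma>0$. Let $\mathsf S$ be uniform on $\{0,1\}$ and let $\mathsf X\sim\mathcal N(A,\sigma^2)$ given $\mathsf S=0$ and $\mathsf X\sim\mathcal N(-A,\sigma^2)$ given $\mathsf S=1$; let $N^+,N^-$ be these two conditional densities and $Q(t)=\Pr(\mathcal N(0,1)>t)$. Let $(\mathsf S_i,\mathsf X_i)_{i\ge 1}$ be i.i.d. copies of $(\mathsf S,\mathsf X)$. For $D_{\mathrm s},D_{\mathrm a}\in[0,\infty]$, a triple $(R,D_{\mathrm s},D_{\mathrm a})$, $R\ge 0$, is achievable if there are measurable encoders $f_n:\mathbb R^n\to\{1,\dots,\lfloor 2^{nR}\rfloor\}$ and decoders $g_n:\{1,\dots,\lfloor 2^{nR}\rfloor\}\to\{0,1\}^n\times\mathbb R^n$ such that, with $(\hat{\mathsf S}^n,\hat{\mathsf X}^n)=g_n(f_n(\mathsf X^n))$, $$\limsup_{n\to\infty}\mathbf E\,\frac1n\sum_{i=1}^n \mathbf 1\{\mathsf S_i\neq\hat{\mathsf S}_i\}\le D_{\mathrm s},\qquad \limsup_{n\to\infty}\mathbf E\,\frac1n\sum_{i=1}^n(\mathsf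 X_i-\hat{\mathsf X}_i)^2\le D_{\mathrm a}.$$ Let $R(D_{\mathrm s},D_{\mathrm a})$ be the infimum of the rates $R$ for which $(R,D_{\mathrm s},D_{\mathrm a})$ is achievable. For every $D$ with $Q(A/\sigma)<D<1/2$ there is exactly one $\lambda<0$ such that $$g(x)=\left[1+\exp\left(\lambda\,\frac{1-e^{-2Ax/\sigma^2}}{1+e^{-2Ax/\sigma^2}}\right)\right]^{-1}\quad\text{satisfies}\quad \int_{-\infty}^{\infty}[N^+(x)-N^-(x)]\,g(x)\,dx=1-2D;$$ call this function $g_D$. For $D\ge 1/2$ put $g_D(x)=1/2$ (the case $\lambda=0$), and for $D=Q(A/\sigma)<1/2$ let $g_D(x)$ be $1$, $1/2$, $0$ for $x>0$, $x=0$, $x<0$ respectively (the limit $\lambda\to-\infty$). Put $$\gamma_D=\int_{-\infty}^{\infty}x\,[N^+(x)+N^-(x)]\,g_D(x)\,dx,\qquad \eta_D=\int_{-\infty}^{\infty}(x-\gamma_D)^2\,[N^+(x)+N^-(x)]\,g_D(x)\,dx.$$ Then for all real $D_{\mathrm s}\ge Q(A/\sigma)$ and $D_{\mathrm a}>0$ the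 following minimum is attained and $$R(D_{\mathrm s},D_{\mathrm a})\;\le\;\min_{D\in[Q(A/\sigma),\,D_{\mathrm s}]}\left\{R(D,\infty)+\frac12\left(\log_2\frac{\eta_D}{D_{\mathrm a}}\right)^+\right\}.$$ -/

import Mathlib

open MeasureTheory ProbabilityTheory Filter Set
open scoped NNReal ENNReal

namespace SemanticRD

noncomputable section

section Coding

variable {𝒮 𝒳 𝒮' 𝒳' : Type*}

/-- The per-letter average of a distortion measure over a block of length `n`. -/
def blockDistortion {α β : Type*} (d : α → β → ℝ≥0) {n : ℕ} (a : Fin n → α) (b : Fin n → β) :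
    ℝ≥0 :=
  (∑ i, d (a i) (b i)) / n

/-- The number of indices available to a code of block length `n` and rate `R` (in bits). -/
def codebookSize (R : ℝ≥0) (n : ℕ) : ℕ := ⌊(2 : ℝ) ^ ((n : ℝ) * (R : ℝ))⌋₊

/-- Achievability of the triple `(R, Ds, Da)` for the memoryless source with single-letter law `p`
on (intrinsic state) × (extrinsic observation): there is a sequence of encoders, which see the
observation block only, and of decoders, which output a pair of reproduction blocks, of rate `R`,
whose expected block distortions under the i.i.d. law of the source are asymptotically at most
`Ds` (for the states) and `Da` (for the observations). The value `∞` imposes no constraint. -/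
def Achievable [MeasurableSpace 𝒮] [MeasurableSpace 𝒳] (p : Measure (𝒮 × 𝒳))
    (ds : 𝒮 → 𝒮' → ℝ≥0) (da : 𝒳 → 𝒳' → ℝ≥0) (R : ℝ≥0) (Ds Da : ℝ≥0∞) : Prop :=
  ∃ (f : ∀ n : ℕ, (Fin n → 𝒳) → Fin (codebookSize R n))
    (g : ∀ n : ℕ, Fin (codebookSize R n) → (Fin n → 𝒮') × (Fin n → 𝒳')),
    (∀ n, Measurable (f n)) ∧
    limsup (fun n : ℕ => ∫⁻ z : Fin n → 𝒮 × 𝒳,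
      (blockDistortion ds (fun i => (z i).1) (g n (f n (fun i => (z i).2))).1 : ℝ≥0∞)
        ∂(Measure.pi fun _ => p)) atTop ≤ Ds ∧
    limsup (fun n : ℕ => ∫⁻ z : Fin n → 𝒮 × 𝒳,
      (blockDistortion da (fun i => (z i).2) (g n (f n (fun i => (z i).2))).2 : ℝ≥0∞)
        ∂(Measure.pi fun _ => p)) atTop ≤ Da

/-- The state-observation rate-distortion function: the least rate `R` (as an infimum) such that
`(R, Ds, Da)` is achievable. -/
def stateObservationRDF [MeasurableSpace 𝒮] [MeasurableSpace 𝒳] (p : Measure (𝒮 × 𝒳))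
    (ds : 𝒮 → 𝒮' → ℝ≥0) (da : 𝒳 → 𝒳' → ℝ≥0) (Ds Da : ℝ≥0∞) : ℝ≥0∞ :=
  ⨅ (R : ℝ≥0) (_ : Achievable p ds da R Ds Da), (R : ℝ≥0∞)

end Coding

/-- Hamming distortion on `{0, 1}`. -/
def hammingDistortion (s t : Fin 2) : ℝ≥0 := if s = t then 0 else 1

/-- Squared error distortion on `ℝ`. -/
def squaredError (x y : ℝ) : ℝ≥0 := ((x - y) ^ 2).toNNReal

/-- The law of `(S, X)`: `S` is uniform on `{0, 1}`, `X ∼ N(A, σ²)` given `S = 0` and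
`X ∼ N(-A, σ²)` given `S = 1`. -/
def source (A σ : ℝ) : Measure (Fin 2 × ℝ) :=
  (2⁻¹ : ℝ≥0∞) • (Measure.dirac (0 : Fin 2)).prod (gaussianReal A (σ ^ 2).toNNReal) +
    (2⁻¹ : ℝ≥0∞) • (Measure.dirac (1 : Fin 2)).prod (gaussianReal (-A) (σ ^ 2).toNNReal)

/-- `R(Ds, Da)` for the binary-state Gaussian-mixture source, in bits per source letter. -/
def sordf (A σ : ℝ) (Ds Da : ℝ≥0∞) : ℝ≥0∞ :=
  stateObservationRDF (source A σ) hammingDistortion squaredError Ds Da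

/-- The Gaussian tail function `Q(t) = P(N(0,1) > t)`. -/
def gaussianQ (t : ℝ) : ℝ := (gaussianReal 0 1).real (Ioi t)

/-- The density `N⁺` of `N(A, σ²)`. -/
def densPos (A σ x : ℝ) : ℝ := gaussianPDFReal A (σ ^ 2).toNNReal x

/-- The density `N⁻` of `N(-A, σ²)`. -/
def densNeg (A σ x : ℝ) : ℝ := gaussianPDFReal (-A) (σ ^ 2).toNNReal x

/-- The parametric family of test channels, `x ↦ P(Ŝ = 0 | X = x)`. -/
def testChannel (A σ lam x : ℝ) : ℝ :=
  (1 + Real.exp (lam * ((1 - Real.exp (-2 * A * x / σ ^ 2)) /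
    (1 + Real.exp (-2 * A * x / σ ^ 2)))))⁻¹

/-- The condition which selects the parameter for the semantic distortion level `D`. -/
def IsParameter (A σ D lam : ℝ) : Prop :=
  lam < 0 ∧ ∫ x, (densPos A σ x - densNeg A σ x) * testChannel A σ lam x = 1 - 2 * D

/-- The parameter `λ` of the optimal test channel at level `D`. -/
def parameter (A σ D : ℝ) : ℝ := Classical.epsilon (IsParameter A σ D)

/-- The optimal test channel `g_D`. For `Q(A/σ) < D < 1/2` it is the member of the family selected
by `IsParameter`. At the two ends it is the pointwise limit of the family: `λ → 0` at `D = 1/2`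
(kept for `D > 1/2`, where the semantic constraint is void), and `λ → -∞`, the hard decision on the
sign of `x`, at `D = Q(A/σ)`. -/
def optimalChannel (A σ D : ℝ) : ℝ → ℝ :=
  if 1 / 2 ≤ D then fun _ => 1 / 2
  else if D ≤ gaussianQ (A / σ) then
    fun x => if 0 < x then 1 else if x = 0 then 1 / 2 else 0
  else testChannel A σ (parameter A σ D)

/-- `γ = ∫ x (N⁺ + N⁻) g_D dx`. -/
def gam (A σ D : ℝ) : ℝ :=
  ∫ x, x * (densPos A σ x + densNeg A σ x) * optimalChannel A σ D x

/-- `η = ∫ (x - γ)² (N⁺ + N⁻) g_D dx`. -/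
def eta (A σ D : ℝ) : ℝ :=
  ∫ x, (x - gam A σ D) ^ 2 * (densPos A σ x + densNeg A σ x) * optimalChannel A σ D x

/-- The rate `R(D, ∞) + ½ (log₂ (η / Da))⁺`. -/
def twoStageRate (A σ Da D : ℝ) : ℝ≥0∞ :=
  sordf A σ (ENNReal.ofReal D) ∞ +
    ENNReal.ofReal (1 / 2 * max (Real.logb 2 (eta A σ D / Da)) 0)

end

end SemanticRD

open SemanticRD

/-!
The rate-distortion function is operational, so the proof has a direct part and a converse, and
the two meet along the curve of the channels `g_D`.

Direct part. For any symmetric channel `g` from `X` to `Ŝ`, append a refinement of the observation: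
given `(X, Ŝ)`, reproduce `X` by `γ(Ŝ) + Z`, where `γ(Ŝ)` is the conditional mean and `Z` is the
output of the forward Gaussian test channel for a variance `v ≥ η` and distortion `Da`. Only the
conditional second moment of `X` enters the mean of the information density, which is at most
`I(X; Ŝ) + ½ log (v / Da)` although `X` is not Gaussian given `Ŝ`
(`IsChannel.integral_refineInfo_le`). A single random codebook of pairs then suffices: the one-shot
covering bound `exists_codebook` and Chebyshev's inequality give `eventually_exists_code`, in which
blocks without a matching codeword are sent to a fallback word, at a cost controlled by second
moments. The state distortion is turned into a function of the observation through its posterior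
mean (`lintegral_blockDistortion_hamming`). The result is `IsChannel.sordf_le`.

Converse. The members of the exponential family satisfy
`log (2 P(Ŝ = t | x)) = ψ(x) + λ P(S ≠ t | x)`. For a fixed codeword, the exponential of the sum of
these terms over a block has mean one, so its value at the chosen codeword has mean at most the
size of the codebook; with `log t ≤ t / M - 1 + log M` this gives `E ψ + λ D ≤ R log 2`
(`IsChannel.le_rate_of_achievable`), and the left side is `I(X; Ŝ)` at the distortion level of the
channel. At `D = Q(A/σ)` the bound follows by letting `λ → -∞`.

Minimum. In the parameter `u = exp λ ∈ [0, 1]` the distortion is continuous and strictly increasing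
from `Q(A/σ)` to `1/2`, which gives existence and uniqueness of `λ`, and the two-stage rate is
continuous by dominated convergence; it attains its minimum on the compact set of the parameters
that respect the level `Ds` (`exists_isMinOn_twoStageRate`). For `A = 0` the two-stage rate is
constant.
-/

open scoped Topology

namespace SemanticRD

/-! ### Product measures with densities -/

theorem lintegral_pi_prod {ι 𝒳 : Type*} [Fintype ι] [MeasurableSpace 𝒳] (ν : Measure 𝒳)
    [IsProbabilityMeasure ν] (f : ι → 𝒳 → ℝ≥0∞) (hf : ∀ i, Measurable (f i)) :
    ∫⁻ z, ∏ i, f i (z i) ∂(Measure.pi fun _ : ι => ν) = ∏ i, ∫⁻ a, f i a ∂ν := by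
  rw [lintegral_prod_eq_prod_lintegral_of_indepFun Finset.univ (fun i (z : ι → 𝒳) => f i (z i))]
  · refine Finset.prod_congr rfl fun i _ => ?_
    exact (measurePreserving_eval (fun _ : ι => ν) i).lintegral_comp (hf i)
  · exact iIndepFun_pi fun i => (hf i).aemeasurable
  · exact fun i => (hf i).comp (measurable_pi_apply i)

theorem pi_withDensity {ι 𝒳 : Type*} [Fintype ι] [MeasurableSpace 𝒳] (ν : Measure 𝒳)
    [IsProbabilityMeasure ν] (w : 𝒳 → ℝ≥0∞) (hw : Measurable w)
    [IsProbabilityMeasure (ν.withDensity w)] :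
    Measure.pi (fun _ : ι => ν.withDensity w) =
      (Measure.pi fun _ : ι => ν).withDensity fun z => ∏ i, w (z i) := by
  refine Measure.pi_eq fun s hs => ?_
  rw [withDensity_apply _ (MeasurableSet.univ_pi hs),
    ← lintegral_indicator (MeasurableSet.univ_pi hs)]
  have h : ∀ z : ι → 𝒳, (univ.pi s).indicator (fun z => ∏ i, w (z i)) z =
      ∏ i, (s i).indicator w (z i) := by
    intro z
    by_cases hz : z ∈ univ.pi s
    · rw [indicator_of_mem hz]
      exact Finset.prod_congr rfl fun i _ => (indicator_of_mem (hz i trivial) _).symm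
    · rw [indicator_of_notMem hz]
      simp only [Set.mem_pi, mem_univ, true_imp_iff, not_forall] at hz
      obtain ⟨i, hi⟩ := hz
      exact (Finset.prod_eq_zero (Finset.mem_univ i) (indicator_of_notMem hi _)).symm
  simp_rw [h]
  rw [lintegral_pi_prod ν (fun i => (s i).indicator w) fun i => hw.indicator (hs i)]
  refine Finset.prod_congr rfl fun i _ => ?_
  rw [withDensity_apply _ (hs i), lintegral_indicator (hs i)]

/-- Integration over a block of i.i.d. pairs whose single-letter law has the density `w` with
respect to a product measure `P × Q`. -/
theorem lintegral_pi_withDensity_prod {ι 𝒳 𝒴 : Type*} [Fintype ι] [MeasurableSpace 𝒳]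
    [MeasurableSpace 𝒴] (P : Measure 𝒳) (Q : Measure 𝒴) [IsProbabilityMeasure P]
    [IsProbabilityMeasure Q] (w : 𝒳 × 𝒴 → ℝ≥0∞) (hw : Measurable w)
    [IsProbabilityMeasure ((P.prod Q).withDensity w)]
    (F : (ι → 𝒳) × (ι → 𝒴) → ℝ≥0∞) (hF : Measurable F) :
    ∫⁻ z, F (fun i => (z i).1, fun i => (z i).2)
        ∂(Measure.pi fun _ : ι => (P.prod Q).withDensity w) =
      ∫⁻ x, ∫⁻ y, (∏ i, w (x i, y i)) * F (x, y) ∂(Measure.pi fun _ => Q)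
        ∂(Measure.pi fun _ => P) := by
  have hG : Measurable fun p : (ι → 𝒳) × (ι → 𝒴) => (∏ i, w (p.1 i, p.2 i)) * F p := by
    fun_prop
  rw [pi_withDensity _ _ hw, lintegral_withDensity_eq_lintegral_mul _ (by fun_prop)
    (by fun_prop), ← lintegral_prod _ hG.aemeasurable,
    ← (measurePreserving_arrowProdEquivProdArrow 𝒳 𝒴 ι (fun _ => P) (fun _ => Q)).lintegral_comp hG]
  rfl

/-! ### Random coding -/

/-- The one-shot covering lemma. If `W` is a transition density with respect to `Q` that is at most
`C` on a set `T`, then some codebook of `M` words misses `T` with probability at most the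
probability of `Tᶜ` under the joint law plus `exp (-M / C)`: average over codebooks drawn from
`Q`. -/
theorem exists_codebook {Ω₁ Ω₂ : Type*} [MeasurableSpace Ω₁] [MeasurableSpace Ω₂]
    (P : Measure Ω₁) (Q : Measure Ω₂) [IsProbabilityMeasure P] [IsProbabilityMeasure Q]
    (W : Ω₁ × Ω₂ → ℝ≥0∞) (hW : Measurable W) (hW1 : ∀ x, ∫⁻ y, W (x, y) ∂Q = 1)
    (T : Set (Ω₁ × Ω₂)) (hT : MeasurableSet T) (C : ℝ) (hC : 0 < C)
    (hWC : ∀ p ∈ T, W p ≤ ENNReal.ofReal C) (M : ℕ) :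
    ∃ c : Fin M → Ω₂, P {x | ∀ j, (x, c j) ∉ T} ≤
      ∫⁻ x, ∫⁻ y, Tᶜ.indicator W (x, y) ∂Q ∂P + ENNReal.ofReal (Real.exp (-(M / C))) := by
  have hS : MeasurableSet {p : (Fin M → Ω₂) × Ω₁ | ∀ j, (p.2, p.1 j) ∉ T} := by
    have : {p : (Fin M → Ω₂) × Ω₁ | ∀ j, (p.2, p.1 j) ∉ T} =
        ⋂ j, (fun p : (Fin M → Ω₂) × Ω₁ => (p.2, p.1 j)) ⁻¹' Tᶜ := by
      ext p; simp
    rw [this]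
    exact MeasurableSet.iInter fun j => (by fun_prop : Measurable
      fun p : (Fin M → Ω₂) × Ω₁ => (p.2, p.1 j)) hT.compl
  obtain ⟨c, hc⟩ := exists_le_lintegral (μ := Measure.pi fun _ : Fin M => Q)
    (f := fun c => P {x | ∀ j, (x, c j) ∉ T}) (measurable_measure_prodMk_left hS).aemeasurable
  refine ⟨c, hc.trans ?_⟩
  -- for a fixed source word the codewords miss independently
  have h1 : ∫⁻ c, P {x | ∀ j, (x, c j) ∉ T} ∂(Measure.pi fun _ : Fin M => Q) =
      ∫⁻ x, Q {y | (x, y) ∉ T} ^ M ∂P := by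
    have e1 : ((Measure.pi fun _ : Fin M => Q).prod P) {p | ∀ j, (p.2, p.1 j) ∉ T} =
      ∫⁻ c, P {x | ∀ j, (x, c j) ∉ T} ∂(Measure.pi fun _ : Fin M => Q) :=
      Measure.prod_apply hS
    rw [← e1, Measure.prod_apply_symm hS]
    refine lintegral_congr fun x => ?_
    have : ((fun c : Fin M → Ω₂ => (c, x)) ⁻¹' {p | ∀ j, (p.2, p.1 j) ∉ T}) =
        univ.pi fun _ => {y | (x, y) ∉ T} := by
      ext c; simp
    rw [this, Measure.pi_pi]
    simp
  rw [h1]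
  calc ∫⁻ x, Q {y | (x, y) ∉ T} ^ M ∂P
      ≤ ∫⁻ x, (∫⁻ y, Tᶜ.indicator W (x, y) ∂Q + ENNReal.ofReal (Real.exp (-(M / C)))) ∂P := by
        refine lintegral_mono fun x => ?_
        have hTx : MeasurableSet {y | (x, y) ∈ T} := measurable_prodMk_left hT
        set a := ∫⁻ y, Tᶜ.indicator W (x, y) ∂Q with ha
        have ha1 : a ≤ 1 := by
          rw [← hW1 x]
          exact lintegral_mono fun y => indicator_le_self _ _ _
        have hat : a ≠ ∞ := ne_top_of_le_ne_top ENNReal.one_ne_top ha1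
        -- the density bound makes a codeword match with probability at least `(1 - a) / C`
        have hsum : 1 ≤ a + ENNReal.ofReal C * Q {y | (x, y) ∈ T} := by
          rw [← hW1 x, ha, ← lintegral_indicator_const hTx,
            ← lintegral_add_left (f := fun y => Tᶜ.indicator W (x, y))
              ((hW.indicator hT.compl).comp measurable_prodMk_left)]
          refine lintegral_mono fun y => ?_
          by_cases hy : (x, y) ∈ T
          · simpa [hy] using hWC _ hy
          · simp [hy]
        have hq : Q {y | (x, y) ∉ T} = ENNReal.ofReal (1 - Q.real {y | (x, y) ∈ T}) := by
          rw [← probReal_compl_eq_one_sub hTx, ofReal_measureReal]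
          rfl
        set t := Q.real {y | (x, y) ∈ T} with ht
        have hsum' : 1 - a.toReal ≤ C * t := by
          have h := ENNReal.toReal_mono (by finiteness) hsum
          rw [ENNReal.toReal_add hat (by finiteness), ENNReal.toReal_mul,
            ENNReal.toReal_ofReal hC.le] at h
          change 1 ≤ a.toReal + C * t at h
          linarith
        have ha1' : a.toReal ≤ 1 := ENNReal.toReal_mono ENNReal.one_ne_top ha1
        have ht1 : t ≤ 1 := measureReal_le_one
        rw [hq, ← ENNReal.ofReal_pow (by linarith), ← ENNReal.ofReal_toReal hat,
          ← ENNReal.ofReal_add ENNReal.toReal_nonneg (Real.exp_nonneg _)]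
        refine ENNReal.ofReal_le_ofReal ?_
        have hb : 0 ≤ (M : ℝ) / C := by positivity
        calc (1 - t) ^ M ≤ Real.exp (-t) ^ M :=
              pow_le_pow_left₀ (by linarith) (Real.one_sub_le_exp_neg t) M
          _ = Real.exp (-(M * t)) := by rw [← Real.exp_nat_mul]; ring_nf
          _ ≤ Real.exp (a.toReal * 0 + (1 - a.toReal) * (-(M / C))) := by
              refine Real.exp_le_exp.mpr ?_
              have : (M : ℝ) / C * (1 - a.toReal) ≤ M / C * (C * t) :=
                mul_le_mul_of_nonneg_left hsum' hb
              have e : (M : ℝ) / C * (C * t) = M * t := by field_simp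
              linarith
          _ ≤ a.toReal * Real.exp 0 + (1 - a.toReal) * Real.exp (-(M / C)) :=
              convexOn_exp.2 (mem_univ _) (mem_univ _) ENNReal.toReal_nonneg (by linarith)
                (by ring)
          _ ≤ a.toReal + Real.exp (-(M / C)) := by
              rw [Real.exp_zero]
              nlinarith [mul_nonneg (ENNReal.toReal_nonneg (a := a))
                (Real.exp_nonneg (-((M : ℝ) / C)))]
    _ = _ := by
        rw [lintegral_add_right _ measurable_const]
        simp

/-- A codebook `c` completed by a fallback word `b` admits a measurable encoder which finds a word
of `c` that matches in the sense of `T` whenever there is one. -/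
theorem exists_measurable_encoder {Ω₁ Ω₂ : Type*} [MeasurableSpace Ω₁] [MeasurableSpace Ω₂]
    (T : Set (Ω₁ × Ω₂)) (hT : MeasurableSet T) {M : ℕ} (c : Fin M → Ω₂) (b : Ω₂) :
    ∃ (f : Ω₁ → Fin (M + 1)) (c' : Fin (M + 1) → Ω₂), Measurable f ∧
      ∀ x, (x, c' (f x)) ∈ T ∨ (c' (f x) = b ∧ ∀ j, (x, c j) ∉ T) := by
  classical
  let p : Ω₁ → ℕ → Prop := fun x k => M ≤ k ∨ ∃ h : k < M, (x, c ⟨k, h⟩) ∈ T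
  have hp : ∀ x, ∃ k, p x k := fun x => ⟨M, Or.inl le_rfl⟩
  have hm : ∀ k, MeasurableSet {x | p x k} := by
    intro k
    by_cases h : k < M
    · have : {x | p x k} = (fun x => (x, c ⟨k, h⟩)) ⁻¹' T := by
        ext x; simp [p, h]
      rw [this]
      exact measurable_prodMk_right hT
    · have : {x | p x k} = univ := by
        ext x; simp [p, not_lt.mp h]
      rw [this]; exact MeasurableSet.univ
  have hle : ∀ x, Nat.find (hp x) ≤ M := fun x => Nat.find_le (Or.inl le_rfl)
  have hmeas : Measurable fun x => Nat.find (hp x) := measurable_find hp hm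
  refine ⟨fun x => Fin.ofNat (M + 1) (Nat.find (hp x)), Fin.snoc c b,
    (measurable_of_countable (Fin.ofNat (M + 1))).comp hmeas, fun x => ?_⟩
  have hfin : Fin.ofNat (M + 1) (Nat.find (hp x)) =
      ⟨Nat.find (hp x), Nat.lt_succ_of_le (hle x)⟩ := by
    ext; simp [Nat.mod_eq_of_lt (Nat.lt_succ_of_le (hle x))]
  simp only [hfin]
  by_cases h : Nat.find (hp x) < M
  · left
    have e : (⟨Nat.find (hp x), Nat.lt_succ_of_le (hle x)⟩ : Fin (M + 1)) =
      Fin.castSucc ⟨Nat.find (hp x), h⟩ := rfl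
    rw [e, Fin.snoc_castSucc]
    rcases Nat.find_spec (hp x) with h' | ⟨_, h'⟩
    · omega
    · exact h'
  · right
    have e : (⟨Nat.find (hp x), Nat.lt_succ_of_le (hle x)⟩ : Fin (M + 1)) = Fin.last M := by
      ext; simp; have := hle x; omega
    rw [e, Fin.snoc_last]
    refine ⟨rfl, fun j hj => ?_⟩
    exact h (lt_of_le_of_lt (Nat.find_le (Or.inr ⟨j.2, hj⟩)) j.2)

/-- Weak law of large numbers, upper tail, from Chebyshev's inequality. -/
theorem tendsto_measure_sum_gt {Ω : Type*} [MeasurableSpace Ω] (μ : Measure Ω)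
    [IsProbabilityMeasure μ] (f : Ω → ℝ) (hf : MemLp f 2 μ) {δ : ℝ} (hδ : 0 < δ) :
    Tendsto (fun n : ℕ => (Measure.pi fun _ : Fin n => μ)
      {z | n * (∫ a, f a ∂μ + δ) < ∑ i, f (z i)}) atTop (𝓝 0) := by
  have hb : ∀ᶠ n : ℕ in atTop, (Measure.pi fun _ : Fin n => μ)
      {z | n * (∫ a, f a ∂μ + δ) < ∑ i, f (z i)} ≤
        ENNReal.ofReal (Var[f; μ] / δ ^ 2 * (n : ℝ)⁻¹) := by
    filter_upwards [eventually_gt_atTop 0] with n hn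
    have hn' : (0 : ℝ) < n := by exact_mod_cast hn
    have hL : ∀ i : Fin n, MemLp (fun z : Fin n → Ω => f (z i)) 2 (Measure.pi fun _ => μ) :=
      fun i => hf.comp_measurePreserving (measurePreserving_eval _ i)
    have hS : MemLp (∑ i, fun z : Fin n → Ω => f (z i)) 2 (Measure.pi fun _ => μ) :=
      memLp_finsetSum' _ fun i _ => hL i
    have hE : ∫ z, (∑ i, fun z : Fin n → Ω => f (z i)) z ∂(Measure.pi fun _ : Fin n => μ) =
        n * ∫ a, f a ∂μ := by
      simp only [Finset.sum_apply]
      rw [integral_finsetSum _ fun i _ => (hL i).integrable one_le_two]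
      have : ∀ i : Fin n, ∫ z : Fin n → Ω, f (z i) ∂(Measure.pi fun _ => μ) = ∫ a, f a ∂μ := by
        intro i
        have h := (measurePreserving_eval (fun _ : Fin n => μ) i)
        conv_rhs => rw [← h.map_eq]
        rw [integral_map h.measurable.aemeasurable (by rw [h.map_eq]; exact hf.1)]
      simp [this]
    have hV : Var[∑ i, fun z : Fin n → Ω => f (z i); Measure.pi fun _ => μ] =
        n * Var[f; μ] := by
      rw [variance_sum_pi fun _ => hf]; simp
    have hcheb := meas_ge_le_variance_div_sq hS (mul_pos hn' hδ)
    rw [hV, hE] at hcheb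
    have e : n * Var[f; μ] / (n * δ) ^ 2 = Var[f; μ] / δ ^ 2 * (n : ℝ)⁻¹ := by
      field_simp
    rw [e] at hcheb
    refine (measure_mono fun z hz => ?_).trans hcheb
    simp only [mem_ofPred_eq, Finset.sum_apply] at hz ⊢
    exact le_trans (by linarith) (le_abs_self _)
  refine tendsto_of_tendsto_of_tendsto_of_le_of_le' tendsto_const_nhds ?_
    (Eventually.of_forall fun _ => zero_le) hb
  rw [← ENNReal.ofReal_zero]
  refine ENNReal.tendsto_ofReal ?_
  simpa using tendsto_inv_atTop_nhds_zero_nat.const_mul (Var[f; μ] / δ ^ 2)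

theorem lt_codebookSize (R : ℝ≥0) (n : ℕ) :
    Real.exp (n * (R * Real.log 2)) < codebookSize R n + 1 := by
  have : Real.exp (n * (R * Real.log 2)) = (2 : ℝ) ^ ((n : ℝ) * (R : ℝ)) := by
    rw [Real.rpow_def_of_pos two_pos]; ring_nf
  rw [this]
  exact Nat.lt_floor_add_one _

theorem codebookSize_le (R : ℝ≥0) (n : ℕ) :
    (codebookSize R n : ℝ) ≤ Real.exp (n * (R * Real.log 2)) := by
  have : Real.exp (n * (R * Real.log 2)) = (2 : ℝ) ^ ((n : ℝ) * (R : ℝ)) := by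
    rw [Real.rpow_def_of_pos two_pos]; ring_nf
  rw [this]
  exact Nat.floor_le (by positivity)

theorem codebookSize_pos (R : ℝ≥0) (n : ℕ) : 0 < codebookSize R n :=
  Nat.floor_pos.mpr (Real.one_le_rpow one_le_two (by positivity))

theorem tendsto_exp_neg_codebookSize {R : ℝ≥0} {K : ℝ} (hK : 0 ≤ K) (hKR : K < R * Real.log 2) :
    Tendsto (fun n : ℕ => Real.exp (-(((codebookSize R n - 1 : ℕ) : ℝ) / Real.exp (n * K))))
      atTop (𝓝 0) := by
  refine Real.tendsto_exp_neg_atTop_nhds_zero.comp ?_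
  have h : Tendsto (fun n : ℕ => Real.exp (n * (R * Real.log 2 - K)) + (-2)) atTop atTop := by
    refine tendsto_atTop_add_const_right _ _ (Real.tendsto_exp_atTop.comp ?_)
    exact tendsto_natCast_atTop_atTop.atTop_mul_const (by linarith)
  refine tendsto_atTop_mono (fun n => ?_) h
  have h1 := lt_codebookSize R n
  have h2 : ((codebookSize R n - 1 : ℕ) : ℝ) = codebookSize R n - 1 := by
    have := codebookSize_pos R n
    push_cast [Nat.cast_sub (show 1 ≤ codebookSize R n from this)]
    ring
  have h3 : (1 : ℝ) ≤ Real.exp (n * K) := Real.one_le_exp (by positivity)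
  rw [h2, le_div_iff₀ (by positivity), mul_sub, Real.exp_sub, add_mul]
  rw [div_mul_cancel₀ _ (Real.exp_ne_zero _)]
  linarith

/-- The pairs of blocks along which the empirical mean of every statistic `h k` is at most `t k`. -/
def typicalSet {𝒳 𝒴 κ : Type*} (h : κ → 𝒳 × 𝒴 → ℝ) (t : κ → ℝ) (n : ℕ) :
    Set ((Fin n → 𝒳) × (Fin n → 𝒴)) :=
  {p | ∀ k, ∑ i, h k (p.1 i, p.2 i) ≤ n * t k}

theorem measurableSet_typicalSet {𝒳 𝒴 κ : Type*} [MeasurableSpace 𝒳] [MeasurableSpace 𝒴]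
    [Countable κ] {h : κ → 𝒳 × 𝒴 → ℝ} (hm : ∀ k, Measurable (h k)) (t : κ → ℝ) (n : ℕ) :
    MeasurableSet (typicalSet h t n) := by
  have : typicalSet h t n = ⋂ k, {p | ∑ i, h k (p.1 i, p.2 i) ≤ n * t k} := by
    ext p; simp [typicalSet]
  rw [this]
  refine MeasurableSet.iInter fun k => measurableSet_le ?_ measurable_const
  have := hm k
  fun_prop

/-- If every threshold exceeds the corresponding mean, then the probability of an atypical pair of
blocks vanishes. -/
theorem tendsto_lintegral_compl_typicalSet {𝒳 𝒴 κ : Type*} [MeasurableSpace 𝒳]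
    [MeasurableSpace 𝒴] [Fintype κ] (P : Measure 𝒳) (Q : Measure 𝒴) [IsProbabilityMeasure P]
    [IsProbabilityMeasure Q] (w : 𝒳 × 𝒴 → ℝ≥0∞) (hw : Measurable w)
    [IsProbabilityMeasure ((P.prod Q).withDensity w)]
    (h : κ → 𝒳 × 𝒴 → ℝ) (hm : ∀ k, Measurable (h k))
    (hL : ∀ k, MemLp (h k) 2 ((P.prod Q).withDensity w)) (t : κ → ℝ)
    (ht : ∀ k, ∫ p, h k p ∂((P.prod Q).withDensity w) < t k) :
    Tendsto (fun n : ℕ => ∫⁻ x, ∫⁻ y, (typicalSet h t n)ᶜ.indicator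
      (fun p => ∏ i, w (p.1 i, p.2 i)) (x, y) ∂(Measure.pi fun _ => Q) ∂(Measure.pi fun _ => P))
      atTop (𝓝 0) := by
  have e3 := tendsto_finsetSum (Finset.univ : Finset κ) fun k _ =>
    tendsto_measure_sum_gt _ (h k) (hL k) (sub_pos.mpr (ht k))
  simp only [Finset.sum_const_zero] at e3
  refine tendsto_of_tendsto_of_tendsto_of_le_of_le tendsto_const_nhds e3
    (fun _ => zero_le) fun n => ?_
  have hTm := measurableSet_typicalSet hm t n
  set T := typicalSet h t n with hT
  have e4 := lintegral_pi_withDensity_prod (ι := Fin n) P Q w hw (Tᶜ.indicator 1)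
    (measurable_one.indicator hTm.compl)
  have e5 : ∫⁻ x, ∫⁻ y, Tᶜ.indicator
      (fun p => ∏ i, w (p.1 i, p.2 i)) (x, y) ∂(Measure.pi fun _ => Q) ∂(Measure.pi fun _ => P) =
      ∫⁻ x, ∫⁻ y, (∏ i, w (x i, y i)) * Tᶜ.indicator 1 (x, y) ∂(Measure.pi fun _ => Q)
        ∂(Measure.pi fun _ => P) := by
    refine lintegral_congr fun x => lintegral_congr fun y => ?_
    by_cases h : (x, y) ∈ T <;> simp [h]
  have hφ : Measurable fun z : Fin n → 𝒳 × 𝒴 =>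
      ((fun i => (z i).1, fun i => (z i).2) : (Fin n → 𝒳) × (Fin n → 𝒴)) := by
    fun_prop
  rw [e5, ← e4]
  have e6 : (fun z : Fin n → 𝒳 × 𝒴 =>
      Tᶜ.indicator (1 : (Fin n → 𝒳) × (Fin n → 𝒴) → ℝ≥0∞)
        (fun i => (z i).1, fun i => (z i).2)) =
      ((fun z : Fin n → 𝒳 × 𝒴 => ((fun i => (z i).1, fun i => (z i).2) :
        (Fin n → 𝒳) × (Fin n → 𝒴))) ⁻¹' Tᶜ).indicator 1 := rfl
  rw [e6, lintegral_indicator_one (hφ hTm.compl)]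
  refine le_trans (measure_mono fun z hz => ?_) (measure_iUnion_fintype_le _ _)
  simp only [hT, typicalSet, mem_preimage, mem_compl_iff, mem_ofPred_eq, not_forall, not_le] at hz
  obtain ⟨k, hk⟩ := hz
  refine mem_iUnion.mpr ⟨k, ?_⟩
  simpa using hk

/-- Achievability by random coding for an arbitrary test channel with transition density `w`, in
the form: at every rate above the mean of an upper bound `ι` of the information density `log w`,
and for all large block lengths, one code attains all the mean distortions of the test channel up
to `ε`. The letter `y₀` is the reproduction used when no codeword matches. -/
theorem eventually_exists_code {𝒳 𝒴 κ : Type*} [MeasurableSpace 𝒳] [MeasurableSpace 𝒴] [Fintype κ]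
    (P : Measure 𝒳) (Q : Measure 𝒴) [IsProbabilityMeasure P] [IsProbabilityMeasure Q]
    (w : 𝒳 × 𝒴 → ℝ≥0∞) (hw : Measurable w) (hw1 : ∀ x, ∫⁻ y, w (x, y) ∂Q = 1)
    [IsProbabilityMeasure ((P.prod Q).withDensity w)]
    (ι : 𝒳 × 𝒴 → ℝ) (hιm : Measurable ι) (hwι : ∀ p, w p ≤ ENNReal.ofReal (Real.exp (ι p)))
    (hι : MemLp ι 2 ((P.prod Q).withDensity w))
    (d : κ → 𝒳 × 𝒴 → ℝ) (hdm : ∀ k, Measurable (d k)) (hd0 : ∀ k p, 0 ≤ d k p)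
    (hd : ∀ k, MemLp (d k) 2 ((P.prod Q).withDensity w))
    (y₀ : 𝒴) (hy₀ : ∀ k, MemLp (fun x => d k (x, y₀)) 2 P)
    {R : ℝ≥0} (hR0 : 0 < R) (hR : ∫ p, ι p ∂((P.prod Q).withDensity w) < R * Real.log 2)
    {ε : ℝ} (hε : 0 < ε) :
    ∀ᶠ n : ℕ in atTop, ∃ f : (Fin n → 𝒳) → Fin (codebookSize R n), Measurable f ∧
      ∃ c : Fin (codebookSize R n) → Fin n → 𝒴, ∀ k,
        ∫⁻ x, (∑ i, ENNReal.ofReal (d k (x i, c (f x) i))) / n ∂(Measure.pi fun _ => P) ≤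
          ENNReal.ofReal (∫ p, d k p ∂((P.prod Q).withDensity w) + ε) := by
  set μ := (P.prod Q).withDensity w with hμ
  have hRl : 0 < R * Real.log 2 := mul_pos (by exact_mod_cast hR0) (Real.log_pos one_lt_two)
  obtain ⟨K, hK1, hK2⟩ := exists_between (max_lt hR hRl)
  have hK0 : 0 < K := lt_of_le_of_lt (le_max_right _ _) hK1
  have hιK : ∫ p, ι p ∂μ < K := lt_of_le_of_lt (le_max_left _ _) hK1
  have hε2 := half_pos hε
  let h : Option κ → 𝒳 × 𝒴 → ℝ := fun o => o.elim ι d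
  let t : Option κ → ℝ := fun o => o.elim K fun k => ∫ q, d k q ∂μ + ε / 2
  have hhm : ∀ o, Measurable (h o) := by rintro (_ | k); exacts [hιm, hdm k]
  have hT0 := tendsto_lintegral_compl_typicalSet P Q w hw h hhm
    (by rintro (_ | k); exacts [hι, hd k]) t
    (by
      rintro (_ | k)
      · exact hιK
      · exact lt_add_of_pos_right _ hε2)
  set T := typicalSet h t with hT
  have hTm : ∀ n, MeasurableSet (T n) := fun n => measurableSet_typicalSet hhm t n
  -- the total second moment of the fallback distortions fixes the truncation level `a`
  set V := ∑ k, ∫ x, d k (x, y₀) ^ 2 ∂P with hV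
  have hVk : ∀ k, ∫ x, d k (x, y₀) ^ 2 ∂P ≤ V := fun k =>
    Finset.single_le_sum (f := fun k => ∫ x, d k (x, y₀) ^ 2 ∂P)
      (fun k _ => integral_nonneg fun _ => sq_nonneg _) (Finset.mem_univ k)
  have hV0 : 0 ≤ V := Finset.sum_nonneg fun k _ => integral_nonneg fun _ => sq_nonneg _
  set a := (V + 1) / (ε / 4) with ha
  have ha0 : 0 < a := by positivity
  have hVa : V / a ≤ ε / 4 := by
    rw [ha, div_div_eq_mul_div, div_le_iff₀ (by positivity)]
    nlinarith
  have hfail : Tendsto (fun n : ℕ => ∫⁻ x, ∫⁻ y, (T n)ᶜ.indicator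
      (fun p => ∏ i, w (p.1 i, p.2 i)) (x, y) ∂(Measure.pi fun _ => Q) ∂(Measure.pi fun _ => P) +
      ENNReal.ofReal (Real.exp (-(((codebookSize R n - 1 : ℕ) : ℝ) / Real.exp (n * K)))))
      atTop (𝓝 0) := by
    have := hT0.add (ENNReal.tendsto_ofReal (tendsto_exp_neg_codebookSize hK0.le hK2))
    simpa using this
  have hpos : (0 : ℝ≥0∞) < ENNReal.ofReal (ε / 4 / a) := by
    rw [ENNReal.ofReal_pos]; positivity
  filter_upwards [hfail.eventually (eventually_le_nhds hpos), eventually_gt_atTop 0] with n hn hn0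
  obtain ⟨m, hm⟩ : ∃ m, codebookSize R n = m + 1 :=
    ⟨codebookSize R n - 1, by have := codebookSize_pos R n; omega⟩
  rw [hm] at hn ⊢
  simp only [Nat.add_sub_cancel] at hn
  have hW1 : ∀ x : Fin n → 𝒳, ∫⁻ y : Fin n → 𝒴, ∏ i, w (x i, y i) ∂(Measure.pi fun _ => Q) = 1 := by
    intro x
    rw [lintegral_pi_prod Q (fun i y => w (x i, y)) fun i => hw.comp measurable_prodMk_left]
    simp [hw1]
  obtain ⟨c, hc⟩ := exists_codebook (Measure.pi fun _ : Fin n => P) (Measure.pi fun _ : Fin n => Q)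
    (fun p => ∏ i, w (p.1 i, p.2 i)) (by fun_prop) hW1 (T n) (hTm n) (Real.exp (n * K))
    (Real.exp_pos _) (fun p hp => by
      calc ∏ i, w (p.1 i, p.2 i) ≤ ∏ i, ENNReal.ofReal (Real.exp (ι (p.1 i, p.2 i))) :=
            Finset.prod_le_prod' fun i _ => hwι _
        _ = ENNReal.ofReal (Real.exp (∑ i, ι (p.1 i, p.2 i))) := by
            rw [← ENNReal.ofReal_prod_of_nonneg fun i _ => (Real.exp_pos _).le, Real.exp_sum]
        _ ≤ _ := ENNReal.ofReal_le_ofReal (Real.exp_le_exp.mpr (hp none))) m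
  obtain ⟨f, c', hf, hfc⟩ := exists_measurable_encoder (T n) (hTm n) c (fun _ => y₀)
  refine ⟨f, hf, c', fun k => ?_⟩
  set B := {x : Fin n → 𝒳 | ∀ j, (x, c j) ∉ T n} with hB
  have hBm : MeasurableSet B := by
    have : B = ⋂ j, (fun x => (x, c j)) ⁻¹' (T n)ᶜ := by ext x; simp [hB]
    rw [this]
    exact MeasurableSet.iInter fun j => measurable_prodMk_right (hTm n).compl
  have hn0' : (n : ℝ≥0∞) ≠ 0 := by exact_mod_cast hn0.ne'
  have hn0r : (0 : ℝ) < n := by exact_mod_cast hn0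
  have hEk : 0 ≤ ∫ q, d k q ∂μ := integral_nonneg (hd0 k)
  have hpt : ∀ x : Fin n → 𝒳, (∑ i, ENNReal.ofReal (d k (x i, c' (f x) i))) / n ≤
      ENNReal.ofReal (∫ q, d k q ∂μ + ε / 2) + (B.indicator (fun _ => ENNReal.ofReal a) x +
        (∑ i, ENNReal.ofReal (d k (x i, y₀) ^ 2 / a)) / n) := by
    intro x
    rcases hfc x with h' | ⟨h1, h2⟩
    · refine le_add_right ?_
      refine ENNReal.div_le_of_le_mul ?_
      rw [← ENNReal.ofReal_sum_of_nonneg fun i _ => hd0 _ _, ← ENNReal.ofReal_natCast n,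
        ← ENNReal.ofReal_mul (by positivity), mul_comm]
      exact ENNReal.ofReal_le_ofReal (h' (some k))
    · refine le_add_left ?_
      rw [h1, indicator_of_mem (show x ∈ B from h2)]
      refine ENNReal.div_le_of_le_mul ?_
      rw [add_mul, ENNReal.div_mul_cancel hn0' (by simp)]
      have : ENNReal.ofReal a * n = ∑ _i : Fin n, ENNReal.ofReal a := by
        simp [mul_comm]
      rw [this, ← Finset.sum_add_distrib]
      refine Finset.sum_le_sum fun i _ => ?_
      rw [← ENNReal.ofReal_add ha0.le (by positivity)]
      refine ENNReal.ofReal_le_ofReal ?_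
      have h0 := hd0 k (x i, y₀)
      -- `t ≤ a + t² / a`
      rw [← sub_le_iff_le_add', le_div_iff₀ ha0]
      nlinarith [sq_nonneg (d k (x i, y₀) - a)]
  have hsq : Integrable (fun x => d k (x, y₀) ^ 2) P := (hy₀ k).integrable_sq
  have hgm : Measurable fun x => ENNReal.ofReal (d k (x, y₀) ^ 2 / a) := by
    have := hdm k
    fun_prop
  have hI3 : ∫⁻ x : Fin n → 𝒳, (∑ i, ENNReal.ofReal (d k (x i, y₀) ^ 2 / a)) / n
      ∂(Measure.pi fun _ => P) ≤ ENNReal.ofReal (ε / 4) := by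
    simp only [div_eq_mul_inv (_ : ℝ≥0∞)]
    rw [lintegral_mul_const _ (by
      exact Finset.measurable_sum _ fun i _ => hgm.comp (measurable_pi_apply i)),
      lintegral_finsetSum (f := fun i (x : Fin n → 𝒳) => ENNReal.ofReal (d k (x i, y₀) ^ 2 / a)) _
        fun i _ => hgm.comp (measurable_pi_apply i)]
    have : ∀ i : Fin n, ∫⁻ x : Fin n → 𝒳, ENNReal.ofReal (d k (x i, y₀) ^ 2 / a)
        ∂(Measure.pi fun _ => P) = ENNReal.ofReal ((∫ x, d k (x, y₀) ^ 2 ∂P) / a) := by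
      intro i
      rw [← integral_div, ofReal_integral_eq_lintegral_ofReal (hsq.div_const a)
        (Eventually.of_forall fun _ => by positivity)]
      exact (measurePreserving_eval (fun _ : Fin n => P) i).lintegral_comp hgm
    simp only [this, Finset.sum_const, Finset.card_univ, Fintype.card_fin, nsmul_eq_mul]
    rw [mul_comm, ← mul_assoc, ENNReal.inv_mul_cancel hn0' (by simp), one_mul]
    refine ENNReal.ofReal_le_ofReal (le_trans ?_ hVa)
    exact div_le_div_of_nonneg_right (hVk k) ha0.le
  calc ∫⁻ x, (∑ i, ENNReal.ofReal (d k (x i, c' (f x) i))) / n ∂(Measure.pi fun _ => P)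
      ≤ ∫⁻ x, (ENNReal.ofReal (∫ q, d k q ∂μ + ε / 2) + (B.indicator (fun _ => ENNReal.ofReal a) x +
        (∑ i, ENNReal.ofReal (d k (x i, y₀) ^ 2 / a)) / n)) ∂(Measure.pi fun _ => P) :=
        lintegral_mono hpt
    _ ≤ ENNReal.ofReal (∫ q, d k q ∂μ + ε / 2) +
        (ENNReal.ofReal a * ENNReal.ofReal (ε / 4 / a) + ENNReal.ofReal (ε / 4)) := by
        rw [lintegral_add_left measurable_const,
          lintegral_add_left (measurable_const.indicator hBm), lintegral_indicator_const hBm,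
          lintegral_const, measure_univ, mul_one]
        gcongr
        exact hc.trans hn
    _ = ENNReal.ofReal (∫ p, d k p ∂μ + ε) := by
        rw [← ENNReal.ofReal_mul ha0.le, ← ENNReal.ofReal_add (by positivity) (by positivity),
          ← ENNReal.ofReal_add (by positivity) (by positivity)]
        congr 1
        field_simp
        ring

theorem limsup_le_of_le_add {u e : ℕ → ℝ≥0∞} {D : ℝ≥0∞} (h : ∀ n, u n ≤ D + e n)
    (he : Tendsto e atTop (𝓝 0)) : limsup u atTop ≤ D := by
  have h1 : Tendsto (fun n => D + e n) atTop (𝓝 D) := by simpa using he.const_add D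
  exact (limsup_le_limsup (Eventually.of_forall h)).trans h1.limsup_eq.le

/-- Achievability up to every `ε > 0`, with codes that may depend on `ε`, gives achievability: for
each block length take a nearly optimal code. -/
theorem achievable_of_eventually {𝒮 𝒳 𝒮' 𝒳' : Type*} [MeasurableSpace 𝒮] [MeasurableSpace 𝒳]
    [Nonempty 𝒮'] [Nonempty 𝒳'] (p : Measure (𝒮 × 𝒳)) (ds : 𝒮 → 𝒮' → ℝ≥0) (da : 𝒳 → 𝒳' → ℝ≥0)
    (R : ℝ≥0) (Ds Da : ℝ≥0∞)
    (h : ∀ ε : ℝ, 0 < ε → ∀ᶠ n : ℕ in atTop, ∃ f : (Fin n → 𝒳) → Fin (codebookSize R n),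
      Measurable f ∧ ∃ g : Fin (codebookSize R n) → (Fin n → 𝒮') × (Fin n → 𝒳'),
        (∫⁻ z : Fin n → 𝒮 × 𝒳, (blockDistortion ds (fun i => (z i).1)
          (g (f (fun i => (z i).2))).1 : ℝ≥0∞) ∂(Measure.pi fun _ => p)) ≤
            Ds + ENNReal.ofReal ε ∧
        (∫⁻ z : Fin n → 𝒮 × 𝒳, (blockDistortion da (fun i => (z i).2)
          (g (f (fun i => (z i).2))).2 : ℝ≥0∞) ∂(Measure.pi fun _ => p)) ≤
            Da + ENNReal.ofReal ε) :
    Achievable p ds da R Ds Da := by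
  let Code : ℕ → Type _ := fun n => {f : (Fin n → 𝒳) → Fin (codebookSize R n) // Measurable f} ×
    (Fin (codebookSize R n) → (Fin n → 𝒮') × (Fin n → 𝒳'))
  have hne : ∀ n, Nonempty (Code n) := fun n =>
    ⟨⟨⟨fun _ => ⟨0, codebookSize_pos R n⟩, measurable_const⟩, Classical.arbitrary _⟩⟩
  let Es : ∀ n, Code n → ℝ≥0∞ := fun n C => ∫⁻ z : Fin n → 𝒮 × 𝒳,
    (blockDistortion ds (fun i => (z i).1) (C.2 (C.1.1 (fun i => (z i).2))).1 : ℝ≥0∞)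
      ∂(Measure.pi fun _ => p)
  let Ea : ∀ n, Code n → ℝ≥0∞ := fun n C => ∫⁻ z : Fin n → 𝒮 × 𝒳,
    (blockDistortion da (fun i => (z i).2) (C.2 (C.1.1 (fun i => (z i).2))).2 : ℝ≥0∞)
      ∂(Measure.pi fun _ => p)
  let e : ∀ n, Code n → ℝ≥0∞ := fun n C => max (Es n C - Ds) (Ea n C - Da)
  have hinf : Tendsto (fun n => ⨅ C, e n C) atTop (𝓝 0) := by
    rw [ENNReal.tendsto_nhds_zero]
    intro δ hδ
    obtain ⟨ε, hε, hεδ⟩ : ∃ ε : ℝ, 0 < ε ∧ ENNReal.ofReal ε ≤ δ := by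
      obtain ⟨r, hr0, hr⟩ := ENNReal.lt_iff_exists_nnreal_btwn.mp hδ
      exact ⟨r, by exact_mod_cast hr0, by simpa using hr.le⟩
    filter_upwards [h ε hε] with n hn
    obtain ⟨f, hf, g, h1, h2⟩ := hn
    refine (iInf_le _ (⟨⟨f, hf⟩, g⟩ : Code n)).trans ((max_le ?_ ?_).trans hεδ)
    · exact tsub_le_iff_left.mpr h1
    · exact tsub_le_iff_left.mpr h2
  have hch : ∀ n : ℕ, ∃ C : Code n, e n C ≤ (⨅ C, e n C) + (n + 1 : ℝ≥0∞)⁻¹ := by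
    intro n
    by_cases ht : (⨅ C, e n C) = ∞
    · exact ⟨Classical.arbitrary _, by simp [ht]⟩
    · obtain ⟨C, hC⟩ := iInf_lt_iff.mp (ENNReal.lt_add_right ht
        (show (n + 1 : ℝ≥0∞)⁻¹ ≠ 0 by simp [ENNReal.add_eq_top]))
      exact ⟨C, hC.le⟩
  choose C hC using hch
  have hinv : Tendsto (fun n : ℕ => (n + 1 : ℝ≥0∞)⁻¹) atTop (𝓝 0) := by
    have := (tendsto_add_atTop_iff_nat 1).mpr ENNReal.tendsto_inv_nat_nhds_zero
    simpa using this
  have he0 : Tendsto (fun n => (⨅ C, e n C) + (n + 1 : ℝ≥0∞)⁻¹) atTop (𝓝 0) := by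
    simpa using hinf.add hinv
  refine ⟨fun n => (C n).1.1, fun n => (C n).2, fun n => (C n).1.2, ?_, ?_⟩
  · refine limsup_le_of_le_add (fun n => ?_) he0
    exact le_add_tsub.trans (add_le_add le_rfl ((le_max_left _ _).trans (hC n)))
  · refine limsup_le_of_le_add (fun n => ?_) he0
    exact le_add_tsub.trans (add_le_add le_rfl ((le_max_right _ _).trans (hC n)))

theorem Achievable.mono {𝒮 𝒳 𝒮' 𝒳' : Type*} [MeasurableSpace 𝒮] [MeasurableSpace 𝒳]
    {p : Measure (𝒮 × 𝒳)} {ds : 𝒮 → 𝒮' → ℝ≥0} {da : 𝒳 → 𝒳' → ℝ≥0} {R : ℝ≥0}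
    {Ds Da Ds' Da' : ℝ≥0∞} (h : Achievable p ds da R Ds Da) (hs : Ds ≤ Ds') (ha : Da ≤ Da') :
    Achievable p ds da R Ds' Da' := by
  obtain ⟨f, g, hf, h1, h2⟩ := h
  exact ⟨f, g, hf, h1.trans hs, h2.trans ha⟩

theorem sordf_anti {A σ : ℝ} {Ds Da Ds' Da' : ℝ≥0∞} (hs : Ds ≤ Ds') (ha : Da ≤ Da') :
    sordf A σ Ds' Da' ≤ sordf A σ Ds Da :=
  le_iInf₂ fun R hR => iInf₂_le R (hR.mono hs ha)

/-! ### The source -/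

noncomputable section

variable {A σ : ℝ}

/-- The uniform law on `{0, 1}`. -/
def coin : Measure (Fin 2) := (2⁻¹ : ℝ≥0∞) • Measure.count

/-- The law of the observation `X`, an equal mixture of `N(A, σ²)` and `N(-A, σ²)`. -/
def mixLaw (A σ : ℝ) : Measure ℝ :=
  (2⁻¹ : ℝ≥0∞) • gaussianReal A (σ ^ 2).toNNReal +
    (2⁻¹ : ℝ≥0∞) • gaussianReal (-A) (σ ^ 2).toNNReal

/-- The density of the observation given the state. -/
def dens (A σ : ℝ) (s : Fin 2) (x : ℝ) : ℝ := if s = 0 then densPos A σ x else densNeg A σ x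

/-- The density of `X`. -/
def mixDens (A σ x : ℝ) : ℝ := (densPos A σ x + densNeg A σ x) / 2

/-- The posterior probability `P(S = s | X = x)`. -/
def posterior (A σ : ℝ) (s : Fin 2) (x : ℝ) : ℝ :=
  dens A σ s x / (densPos A σ x + densNeg A σ x)

instance : IsProbabilityMeasure coin :=
  ⟨by simp [coin, Measure.count_univ, ENNReal.inv_mul_cancel]⟩

instance (A σ : ℝ) : IsProbabilityMeasure (mixLaw A σ) :=
  ⟨by simp [mixLaw, ENNReal.inv_two_add_inv_two]⟩

theorem lintegral_coin (f : Fin 2 → ℝ≥0∞) : ∫⁻ s, f s ∂coin = 2⁻¹ * ∑ s, f s := by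
  simp [coin, lintegral_count, tsum_fintype]

theorem variance_ne_zero (hσ : 0 < σ) : (σ ^ 2).toNNReal ≠ 0 := by
  simp; positivity

theorem densPos_pos (hσ : 0 < σ) (x : ℝ) : 0 < densPos A σ x :=
  gaussianPDFReal_pos _ _ _ (variance_ne_zero hσ)

theorem densNeg_pos (hσ : 0 < σ) (x : ℝ) : 0 < densNeg A σ x :=
  gaussianPDFReal_pos _ _ _ (variance_ne_zero hσ)

@[fun_prop]
theorem measurable_densPos : Measurable (densPos A σ) := measurable_gaussianPDFReal _ _

@[fun_prop]
theorem measurable_densNeg : Measurable (densNeg A σ) := measurable_gaussianPDFReal _ _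

@[fun_prop]
theorem measurable_mixDens : Measurable (mixDens A σ) := by unfold mixDens; fun_prop

theorem dens_pos (hσ : 0 < σ) (s : Fin 2) (x : ℝ) : 0 < dens A σ s x := by
  unfold dens; split_ifs
  exacts [densPos_pos hσ x, densNeg_pos hσ x]

theorem mixDens_pos (hσ : 0 < σ) (x : ℝ) : 0 < mixDens A σ x := by
  have := densPos_pos (A := A) hσ x
  have := densNeg_pos (A := A) hσ x
  unfold mixDens; positivity

@[fun_prop]
theorem measurable_dens (s : Fin 2) : Measurable (dens A σ s) := by
  unfold dens; split_ifs <;> fun_prop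

@[fun_prop]
theorem measurable_posterior (s : Fin 2) : Measurable (posterior A σ s) := by
  unfold posterior; fun_prop

theorem mixDens_mul_posterior (hσ : 0 < σ) (s : Fin 2) (x : ℝ) :
    mixDens A σ x * posterior A σ s x = dens A σ s x / 2 := by
  have h1 := densPos_pos (A := A) hσ x
  have h2 := densNeg_pos (A := A) hσ x
  have : densPos A σ x + densNeg A σ x ≠ 0 := by positivity
  unfold mixDens posterior
  field_simp

theorem posterior_nonneg (hσ : 0 < σ) (s : Fin 2) (x : ℝ) : 0 ≤ posterior A σ s x := by
  have h1 := densPos_pos (A := A) hσ x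
  have h2 := densNeg_pos (A := A) hσ x
  have h3 := dens_pos (A := A) hσ s x
  unfold posterior; positivity

theorem posterior_add (hσ : 0 < σ) (x : ℝ) : posterior A σ 0 x + posterior A σ 1 x = 1 := by
  have h1 := densPos_pos (A := A) hσ x
  have h2 := densNeg_pos (A := A) hσ x
  have : densPos A σ x + densNeg A σ x ≠ 0 := by positivity
  simp only [posterior, dens]
  simp only [if_true, one_ne_zero, if_false]
  field_simp

theorem mixLaw_eq_withDensity (hσ : 0 < σ) :
    mixLaw A σ = volume.withDensity fun x => ENNReal.ofReal (mixDens A σ x) := by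
  have h2 : (2⁻¹ : ℝ≥0∞) = ENNReal.ofReal (1 / 2) := by
    rw [ENNReal.ofReal_div_of_pos two_pos]; simp
  rw [mixLaw, gaussianReal_of_var_ne_zero _ (variance_ne_zero hσ),
    gaussianReal_of_var_ne_zero _ (variance_ne_zero hσ),
    ← withDensity_smul _ (measurable_gaussianPDF _ _),
    ← withDensity_smul _ (measurable_gaussianPDF _ _), ← withDensity_add_left (by
      exact (measurable_gaussianPDF _ _).const_smul _)]
  congr 1
  ext x
  simp only [Pi.add_apply, Pi.smul_apply, smul_eq_mul, gaussianPDF, h2]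
  rw [← ENNReal.ofReal_mul (by positivity), ← ENNReal.ofReal_mul (by positivity),
    ← ENNReal.ofReal_add (by have := gaussianPDFReal_nonneg A (σ ^ 2).toNNReal x; positivity)
      (by have := gaussianPDFReal_nonneg (-A) (σ ^ 2).toNNReal x; positivity)]
  simp only [mixDens, densPos, densNeg]
  ring_nf

theorem lintegral_mixLaw (hσ : 0 < σ) {f : ℝ → ℝ≥0∞} (hf : Measurable f) :
    ∫⁻ x, f x ∂mixLaw A σ = ∫⁻ x, ENNReal.ofReal (mixDens A σ x) * f x := by
  rw [mixLaw_eq_withDensity hσ, lintegral_withDensity_eq_lintegral_mul _ (by fun_prop) hf]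
  rfl

theorem integral_mixLaw (hσ : 0 < σ) (f : ℝ → ℝ) :
    ∫ x, f x ∂mixLaw A σ = ∫ x, mixDens A σ x * f x := by
  rw [mixLaw_eq_withDensity hσ, integral_withDensity_eq_integral_toReal_smul (by fun_prop)
    (Eventually.of_forall fun _ => ENNReal.ofReal_lt_top)]
  refine integral_congr_ae (Eventually.of_forall fun x => ?_)
  simp [ENNReal.toReal_ofReal (mixDens_pos hσ x).le]

/-- The likelihood ratio of the source with respect to the product of its marginals. -/
def likelihood (A σ : ℝ) (p : Fin 2 × ℝ) : ℝ≥0∞ := ENNReal.ofReal (2 * posterior A σ p.1 p.2)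

@[fun_prop]
theorem measurable_likelihood : Measurable (likelihood A σ) :=
  measurable_from_prod_countable_right fun s => by
    simp only [likelihood]; fun_prop

theorem source_eq_withDensity (hσ : 0 < σ) :
    source A σ = (coin.prod (mixLaw A σ)).withDensity (likelihood A σ) := by
  refine Measure.ext_of_lintegral _ fun f hf => ?_
  rw [lintegral_withDensity_eq_lintegral_mul _ measurable_likelihood hf,
    lintegral_prod _ (by fun_prop), lintegral_coin, source, lintegral_add_measure,
    lintegral_smul_measure, lintegral_smul_measure, lintegral_prod _ hf.aemeasurable,
    lintegral_prod _ hf.aemeasurable, lintegral_dirac, lintegral_dirac, Fin.sum_univ_two, mul_add]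
  have key : ∀ s : Fin 2, ∫⁻ x, (likelihood A σ * f) (s, x) ∂mixLaw A σ =
      ∫⁻ x, ENNReal.ofReal (dens A σ s x) * f (s, x) := by
    intro s
    rw [lintegral_mixLaw hσ (by fun_prop)]
    refine lintegral_congr fun x => ?_
    rw [Pi.mul_apply, likelihood, ← mul_assoc, ← ENNReal.ofReal_mul (mixDens_pos hσ x).le]
    congr 2
    have := mixDens_mul_posterior (A := A) hσ s x
    linear_combination 2 * this
  rw [key, key, gaussianReal_of_var_ne_zero _ (variance_ne_zero hσ),
    gaussianReal_of_var_ne_zero _ (variance_ne_zero hσ),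
    lintegral_withDensity_eq_lintegral_mul _ (measurable_gaussianPDF _ _) (by fun_prop),
    lintegral_withDensity_eq_lintegral_mul _ (measurable_gaussianPDF _ _) (by fun_prop)]
  rfl

instance (A σ : ℝ) : IsProbabilityMeasure (source A σ) :=
  ⟨by simp [source, ENNReal.inv_two_add_inv_two]⟩

/-- Averaging over the states given the observations replaces the state at one position by its
posterior law. -/
theorem lintegral_pi_source (hσ : 0 < σ) {n : ℕ} (i : Fin n) (φ : Fin 2 → (Fin n → ℝ) → ℝ≥0∞)
    (hφ : ∀ s, Measurable (φ s)) :
    ∫⁻ z, φ (z i).1 (fun j => (z j).2) ∂(Measure.pi fun _ : Fin n => source A σ) =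
      ∫⁻ x, ∑ s, ENNReal.ofReal (posterior A σ s (x i)) * φ s x
        ∂(Measure.pi fun _ : Fin n => mixLaw A σ) := by
  have hprob : IsProbabilityMeasure ((coin.prod (mixLaw A σ)).withDensity (likelihood A σ)) := by
    rw [← source_eq_withDensity hσ]; infer_instance
  have hφ' : Measurable (Function.uncurry φ) := measurable_from_prod_countable_right hφ
  have hF : Measurable fun p : (Fin n → Fin 2) × (Fin n → ℝ) => φ (p.1 i) p.2 :=
    hφ'.comp (by fun_prop : Measurable fun p : (Fin n → Fin 2) × (Fin n → ℝ) => (p.1 i, p.2))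
  rw [source_eq_withDensity hσ, lintegral_pi_withDensity_prod (ι := Fin n) coin (mixLaw A σ) _
    measurable_likelihood _ hF, lintegral_lintegral_swap (by fun_prop)]
  refine lintegral_congr fun x => ?_
  classical
  have h1 : ∀ s : Fin n → Fin 2, (∏ j, likelihood A σ (s j, x j)) * φ (s i) x =
      ∏ j, (likelihood A σ (s j, x j) * if j = i then φ (s j) x else 1) := by
    intro s
    rw [Finset.prod_mul_distrib, Finset.prod_ite_eq' Finset.univ i]
    simp
  simp_rw [h1]
  rw [lintegral_pi_prod coin (fun j s => likelihood A σ (s, x j) * if j = i then φ s x else 1)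
    fun j => measurable_of_countable _]
  have h2 : ∀ s j, likelihood A σ (s, x j) = 2 * ENNReal.ofReal (posterior A σ s (x j)) := by
    intro s j
    simp [likelihood, ENNReal.ofReal_mul]
  rw [Finset.prod_eq_single i]
  · rw [lintegral_coin, Finset.mul_sum]
    refine Finset.sum_congr rfl fun s _ => ?_
    rw [h2, if_pos rfl, ← mul_assoc, ← mul_assoc,
      ENNReal.inv_mul_cancel two_ne_zero ENNReal.ofNat_ne_top, one_mul]
  · intro j _ hj
    rw [lintegral_coin]
    simp only [h2, if_neg hj, mul_one, Fin.sum_univ_two]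
    rw [← mul_add, ← mul_assoc, ENNReal.inv_mul_cancel two_ne_zero ENNReal.ofNat_ne_top, one_mul,
      ← ENNReal.ofReal_add (posterior_nonneg hσ _ _) (posterior_nonneg hσ _ _),
      posterior_add hσ, ENNReal.ofReal_one]
  · simp

/-- The probability `P(S ≠ t | X = x)` that the reproduction `t` of the state is wrong. -/
def errProb (A σ : ℝ) (t : Fin 2) (x : ℝ) : ℝ := posterior A σ (1 - t) x

@[fun_prop]
theorem measurable_errProb (t : Fin 2) : Measurable (errProb A σ t) := measurable_posterior _

theorem errProb_nonneg (hσ : 0 < σ) (t : Fin 2) (x : ℝ) : 0 ≤ errProb A σ t x :=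
  posterior_nonneg hσ _ x

theorem errProb_zero (x : ℝ) : errProb A σ 0 x = posterior A σ 1 x := rfl

theorem errProb_one (x : ℝ) : errProb A σ 1 x = posterior A σ 0 x := rfl

theorem errProb_add (hσ : 0 < σ) (x : ℝ) : errProb A σ 0 x + errProb A σ 1 x = 1 := by
  rw [errProb_zero, errProb_one, add_comm, posterior_add hσ]

theorem errProb_le_one (hσ : 0 < σ) (t : Fin 2) (x : ℝ) : errProb A σ t x ≤ 1 := by
  have h0 := errProb_nonneg (A := A) hσ 0 x
  have h1 := errProb_nonneg (A := A) hσ 1 x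
  have := errProb_add (A := A) hσ x
  fin_cases t
  · change errProb A σ 0 x ≤ 1; linarith
  · change errProb A σ 1 x ≤ 1; linarith

theorem coe_blockDistortion {α β : Type*} (d : α → β → ℝ≥0) {n : ℕ} (hn : n ≠ 0) (a : Fin n → α)
    (b : Fin n → β) :
    (blockDistortion d a b : ℝ≥0∞) = (∑ i, (d (a i) (b i) : ℝ≥0∞)) / n := by
  rw [blockDistortion, ENNReal.coe_div (by exact_mod_cast hn)]
  simp

/-- The error probability at one position of a reproduction computed from the observations. -/
theorem lintegral_hamming_eval (hσ : 0 < σ) {n : ℕ} (i : Fin n) (r : (Fin n → ℝ) → Fin 2)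
    (hr : Measurable r) :
    ∫⁻ z, (hammingDistortion (z i).1 (r fun i => (z i).2) : ℝ≥0∞)
      ∂(Measure.pi fun _ : Fin n => source A σ) =
    ∫⁻ x, ENNReal.ofReal (errProb A σ (r x) (x i))
      ∂(Measure.pi fun _ : Fin n => mixLaw A σ) := by
  rw [lintegral_pi_source hσ i (fun s x => (hammingDistortion s (r x) : ℝ≥0∞)) fun s =>
    (measurable_of_countable fun t => (hammingDistortion s t : ℝ≥0∞)).comp hr]
  refine lintegral_congr fun x => ?_
  generalize r x = t
  rw [Fin.sum_univ_two]
  fin_cases t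
  · simp [errProb_zero, hammingDistortion]
  · simp [errProb_one, hammingDistortion]

theorem lintegral_sum_div {ι Ω : Type*} [Fintype ι] [MeasurableSpace Ω] (μ : Measure Ω)
    (F : ι → Ω → ℝ≥0∞) (hF : ∀ i, Measurable (F i)) (c : ℝ≥0∞) :
    ∫⁻ ω, (∑ i, F i ω) / c ∂μ = (∑ i, ∫⁻ ω, F i ω ∂μ) / c := by
  simp only [div_eq_mul_inv]
  rw [lintegral_mul_const _ (Finset.measurable_sum _ fun i _ => hF i),
    lintegral_finsetSum _ fun i _ => hF i]

/-- The mean Hamming distortion of a code that only sees the observations is the mean of the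
posterior error probabilities. -/
theorem lintegral_blockDistortion_hamming (hσ : 0 < σ) {n : ℕ} (hn : n ≠ 0)
    (r : (Fin n → ℝ) → Fin n → Fin 2) (hr : ∀ i, Measurable fun x => r x i) :
    ∫⁻ z, (blockDistortion hammingDistortion (fun i => (z i).1) (r fun i => (z i).2) : ℝ≥0∞)
      ∂(Measure.pi fun _ : Fin n => source A σ) =
    ∫⁻ x, (∑ i, ENNReal.ofReal (errProb A σ (r x i) (x i))) / n
      ∂(Measure.pi fun _ : Fin n => mixLaw A σ) := by
  simp only [coe_blockDistortion _ hn]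
  have hh : Measurable fun p : Fin 2 × Fin 2 => (hammingDistortion p.1 p.2 : ℝ≥0∞) :=
    measurable_of_countable _
  have he : Measurable fun p : Fin 2 × ℝ => ENNReal.ofReal (errProb A σ p.1 p.2) :=
    measurable_from_prod_countable_right fun s => (measurable_errProb s).ennreal_ofReal
  have hsnd : Measurable fun (z : Fin n → Fin 2 × ℝ) (i : Fin n) => (z i).2 :=
    measurable_pi_lambda _ fun i => measurable_snd.comp (measurable_pi_apply i)
  have e1 := lintegral_sum_div (Measure.pi fun _ : Fin n => source A σ)
    (fun i (z : Fin n → Fin 2 × ℝ) =>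
      (hammingDistortion (z i).1 (r (fun i => (z i).2) i) : ℝ≥0∞))
    (fun i => hh.comp ((measurable_fst.comp (measurable_pi_apply i)).prodMk ((hr i).comp hsnd))) n
  have hm : ∀ i, Measurable fun x : Fin n → ℝ => ENNReal.ofReal (errProb A σ (r x i) (x i)) := by
    intro i
    have := he.comp ((hr i).prodMk (measurable_pi_apply i))
    simpa only [Function.comp_def] using this
  have e2 := lintegral_sum_div (Measure.pi fun _ : Fin n => mixLaw A σ)
    (fun i (x : Fin n → ℝ) => ENNReal.ofReal (errProb A σ (r x i) (x i)))
    hm n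
  refine e1.trans (Eq.trans ?_ e2.symm)
  congr 1
  exact Finset.sum_congr rfl fun i _ => lintegral_hamming_eval hσ i (fun x => r x i) (hr i)

theorem lintegral_pi_source_snd (hσ : 0 < σ) {n : ℕ} (hn : n ≠ 0) (F : (Fin n → ℝ) → ℝ≥0∞)
    (hF : Measurable F) :
    ∫⁻ z, F (fun i => (z i).2) ∂(Measure.pi fun _ : Fin n => source A σ) =
      ∫⁻ x, F x ∂(Measure.pi fun _ : Fin n => mixLaw A σ) := by
  rw [lintegral_pi_source hσ ⟨0, Nat.pos_of_ne_zero hn⟩ (fun _ => F) fun _ => hF]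
  refine lintegral_congr fun x => ?_
  rw [← Finset.sum_mul, Fin.sum_univ_two,
    ← ENNReal.ofReal_add (posterior_nonneg hσ _ _) (posterior_nonneg hσ _ _), posterior_add hσ]
  simp

/-! ### Binary test channels and their characteristics -/

/-- `g x` is the probability of the reproduction `0` given the observation `x`, for a test channel
that treats the two states symmetrically. -/
structure IsChannel (g : ℝ → ℝ) : Prop where
  measurable : Measurable g
  nonneg : ∀ x, 0 ≤ g x
  map_neg : ∀ x, g (-x) = 1 - g x

theorem IsChannel.le_one {g : ℝ → ℝ} (hg : IsChannel g) (x : ℝ) : g x ≤ 1 := by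
  have := hg.nonneg (-x)
  rw [hg.map_neg] at this
  linarith

/-- The transition probabilities `P(Ŝ = s | X = x)` of the channel `g`. -/
def trans (g : ℝ → ℝ) (s : Fin 2) (x : ℝ) : ℝ := if s = 0 then g x else 1 - g x

theorem trans_zero (g : ℝ → ℝ) (x : ℝ) : trans g 0 x = g x := rfl

theorem trans_one (g : ℝ → ℝ) (x : ℝ) : trans g 1 x = 1 - g x := rfl

theorem IsChannel.trans_nonneg {g : ℝ → ℝ} (hg : IsChannel g) (s : Fin 2) (x : ℝ) :
    0 ≤ trans g s x := by
  unfold trans; split_ifs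
  exacts [hg.nonneg x, sub_nonneg.mpr (hg.le_one x)]

theorem IsChannel.trans_le_one {g : ℝ → ℝ} (hg : IsChannel g) (s : Fin 2) (x : ℝ) :
    trans g s x ≤ 1 := by
  unfold trans; split_ifs
  exacts [hg.le_one x, sub_le_self _ (hg.nonneg x)]

theorem IsChannel.measurable_trans {g : ℝ → ℝ} (hg : IsChannel g) (s : Fin 2) :
    Measurable (trans g s) := by
  have := hg.measurable
  unfold trans; split_ifs <;> fun_prop

theorem IsChannel.trans_neg {g : ℝ → ℝ} (hg : IsChannel g) (x : ℝ) :
    trans g 1 (-x) = trans g 0 x := by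
  rw [trans_one, trans_zero, hg.map_neg]; ring

/-- The semantic distortion `P(S ≠ Ŝ)` of the channel `g`. -/
def semDist (A σ : ℝ) (g : ℝ → ℝ) : ℝ :=
  (1 - ∫ x, (densPos A σ x - densNeg A σ x) * g x) / 2

/-- The mutual information `I(X; Ŝ)` of a symmetric channel `g`, in nats. -/
def info (A σ : ℝ) (g : ℝ → ℝ) : ℝ :=
  ∫ x, ∑ s, trans g s x * Real.log (2 * trans g s x) ∂mixLaw A σ

/-- The conditional mean of `X` given `Ŝ = 0`. -/
def condMean (A σ : ℝ) (g : ℝ → ℝ) : ℝ :=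
  ∫ x, x * (densPos A σ x + densNeg A σ x) * g x

/-- The conditional variance of `X` given `Ŝ`. -/
def condVar (A σ : ℝ) (g : ℝ → ℝ) : ℝ :=
  ∫ x, (x - condMean A σ g) ^ 2 * (densPos A σ x + densNeg A σ x) * g x

/-- The conditional mean `± γ` of `X` given `Ŝ = s`. -/
def centre (γ : ℝ) (s : Fin 2) : ℝ := if s = 0 then γ else -γ

theorem densPos_neg (x : ℝ) : densPos A σ (-x) = densNeg A σ x := by
  simp only [densPos, densNeg, gaussianPDFReal]
  congr 3; ring

theorem densNeg_neg (x : ℝ) : densNeg A σ (-x) = densPos A σ x := by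
  simp only [densPos, densNeg, gaussianPDFReal]
  congr 3; ring

theorem mixDens_neg (x : ℝ) : mixDens A σ (-x) = mixDens A σ x := by
  rw [mixDens, mixDens, densPos_neg, densNeg_neg, add_comm]

theorem integral_mixLaw_neg (hσ : 0 < σ) (f : ℝ → ℝ) :
    ∫ x, f (-x) ∂mixLaw A σ = ∫ x, f x ∂mixLaw A σ := by
  rw [integral_mixLaw hσ, integral_mixLaw hσ, ← integral_neg_eq_self]
  simp [mixDens_neg]

theorem memLp_id_mixLaw (p : ℝ≥0∞) (hp : p ≠ ∞) : MemLp id p (mixLaw A σ) := by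
  rcases eq_or_ne p 0 with rfl | hp0
  · rw [memLp_zero_iff_aestronglyMeasurable]; fun_prop
  have h : ∀ m, Integrable (fun x => ‖id x‖ ^ p.toReal)
      ((2⁻¹ : ℝ≥0∞) • gaussianReal m (σ ^ 2).toNNReal) := fun m =>
    ((integrable_norm_rpow_iff (by fun_prop) hp0 hp).mpr (memLp_id_gaussianReal' p hp)).smul_measure
      (by simp)
  exact (integrable_norm_rpow_iff (by fun_prop) hp0 hp).mp ((h A).add_measure (h (-A)))

theorem integrable_pow_mixLaw (k : ℕ) : Integrable (fun x => x ^ k) (mixLaw A σ) := by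
  have h := memLp_id_mixLaw (A := A) (σ := σ) k (by simp)
  have := h.integrable_norm_pow'
  refine (integrable_norm_iff (by fun_prop)).mp ?_
  simpa using this

theorem IsChannel.integrable_mul {g : ℝ → ℝ} (hg : IsChannel g) (s : Fin 2) {f : ℝ → ℝ}
    {μ : Measure ℝ} (hf : Integrable f μ) : Integrable (fun x => trans g s x * f x) μ := by
  refine hf.bdd_mul (c := 1) (hg.measurable_trans s).aestronglyMeasurable
    (Eventually.of_forall fun x => ?_)
  rw [Real.norm_of_nonneg (hg.trans_nonneg s x)]
  exact hg.trans_le_one s x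

theorem integrable_densPos : Integrable (densPos A σ) := integrable_gaussianPDFReal _ _

theorem integrable_densNeg : Integrable (densNeg A σ) := integrable_gaussianPDFReal _ _

theorem integral_densPos (hσ : 0 < σ) : ∫ x, densPos A σ x = 1 :=
  integral_gaussianPDFReal_eq_one _ (variance_ne_zero hσ)

theorem integral_densNeg (hσ : 0 < σ) : ∫ x, densNeg A σ x = 1 :=
  integral_gaussianPDFReal_eq_one _ (variance_ne_zero hσ)

theorem IsChannel.integral_errProb (hσ : 0 < σ) {g : ℝ → ℝ} (hg : IsChannel g) :
    ∫ x, ∑ s, trans g s x * errProb A σ s x ∂mixLaw A σ = semDist A σ g := by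
  rw [integral_mixLaw hσ]
  have h : ∀ x, mixDens A σ x * ∑ s, trans g s x * errProb A σ s x =
      (densPos A σ x - (densPos A σ x - densNeg A σ x) * g x) / 2 := by
    intro x
    have h0 := mixDens_mul_posterior (A := A) hσ 0 x
    have h1 := mixDens_mul_posterior (A := A) hσ 1 x
    simp only [dens, if_true, one_ne_zero, if_false] at h0 h1
    rw [Fin.sum_univ_two, trans_zero, trans_one, errProb_zero, errProb_one]
    linear_combination g x * h1 + (1 - g x) * h0
  simp_rw [h]
  rw [integral_div, integral_sub integrable_densPos, integral_densPos hσ, semDist]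
  have := hg.integrable_mul 0 ((integrable_densPos (A := A) (σ := σ)).sub
    (integrable_densNeg (A := A) (σ := σ)))
  refine this.congr (Eventually.of_forall fun x => ?_)
  simp [trans_zero, mul_comm]

theorem IsChannel.integral_sq_sub_centre (hσ : 0 < σ) {g : ℝ → ℝ} (hg : IsChannel g) :
    ∫ x, ∑ s, trans g s x * (x - centre (condMean A σ g) s) ^ 2 ∂mixLaw A σ = condVar A σ g := by
  set γ := condMean A σ g with hγ
  have hi : ∀ c : ℝ, Integrable (fun x : ℝ => (x - c) ^ 2) (mixLaw A σ) := by
    intro c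
    have h := ((integrable_pow_mixLaw (A := A) (σ := σ) 2).sub
      ((integrable_pow_mixLaw (A := A) (σ := σ) 1).const_mul (2 * c))).add
      (integrable_const (c ^ 2))
    refine h.congr (Eventually.of_forall fun x => ?_)
    simp only [Pi.add_apply, Pi.sub_apply]
    ring
  simp only [Fin.sum_univ_two]
  rw [integral_add (hg.integrable_mul 0 (hi _)) (hg.integrable_mul 1 (hi _)),
    ← integral_mixLaw_neg hσ fun x => trans g 1 x * (x - centre γ 1) ^ 2]
  have h : ∀ x, trans g 1 (-x) * (-x - centre γ 1) ^ 2 = trans g 0 x * (x - centre γ 0) ^ 2 := by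
    intro x
    rw [hg.trans_neg]
    simp only [centre, if_true, one_ne_zero, if_false]
    ring
  simp_rw [h]
  rw [← two_mul, integral_mixLaw hσ, condVar, ← hγ, ← integral_const_mul]
  refine integral_congr_ae (Eventually.of_forall fun x => ?_)
  simp only [centre, if_true, trans_zero, mixDens]
  ring

/-! ### The test channel with a Gaussian refinement -/

theorem abs_mul_log_two_mul_le {t : ℝ} (h0 : 0 ≤ t) (h1 : t ≤ 1) :
    |t * Real.log (2 * t)| ≤ 1 := by
  rcases h0.eq_or_lt with rfl | h0
  · simp
  rcases le_total (2 * t) 1 with h | h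
  · have := Real.abs_log_mul_self_lt (2 * t) (by positivity) h
    rw [← mul_assoc, mul_comm _ (2 : ℝ), mul_assoc, abs_mul, abs_two, mul_comm (Real.log _)] at this
    linarith
  · have hl := Real.log_nonneg h
    have := Real.log_le_sub_one_of_pos (show 0 < 2 * t by positivity)
    rw [abs_of_nonneg (by positivity)]
    nlinarith

theorem mul_log_two_mul_sq_le {t : ℝ} (h0 : 0 ≤ t) (h1 : t ≤ 1) :
    2 * t * Real.log (2 * t) ^ 2 ≤ 4 := by
  rcases h0.eq_or_lt with rfl | h0
  · simp
  rcases le_total (2 * t) 1 with h | h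
  · -- with `r = √(2t)`, the left side is `(2 r log r)²`
    have hr0 : 0 < √(2 * t) := by positivity
    have hr1 : √(2 * t) ≤ 1 := Real.sqrt_le_one.mpr h
    have hsq : √(2 * t) ^ 2 = 2 * t := Real.sq_sqrt (by positivity)
    have := Real.abs_log_mul_self_lt _ hr0 hr1
    have h2 : (Real.log √(2 * t) * √(2 * t)) ^ 2 ≤ 1 := by
      rw [← sq_abs]
      exact pow_le_one₀ (abs_nonneg _) this.le
    have h3 : Real.log (2 * t) = 2 * Real.log √(2 * t) := by
      rw [Real.log_sqrt (by positivity)]; ring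
    rw [h3]
    calc 2 * t * (2 * Real.log √(2 * t)) ^ 2 = 4 * (Real.log √(2 * t) * √(2 * t)) ^ 2 := by
          rw [mul_pow, mul_pow, hsq]; ring
      _ ≤ 4 := by linarith
  · have hl := Real.log_nonneg h
    have := Real.log_le_sub_one_of_pos (show 0 < 2 * t by positivity)
    have : Real.log (2 * t) ^ 2 ≤ 1 := pow_le_one₀ hl (by linarith)
    nlinarith

/-- The logarithm of the density of `N(h (v - D) / v, (v - D) D / v)` with respect to
`N(0, v - D)`: the information density at `(h, z)` of the forward Gaussian test channel for
variance `v` and distortion `D`. -/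
def gaussExponent (D v h z : ℝ) : ℝ :=
  Real.log (v / D) / 2 + z ^ 2 / (2 * (v - D)) -
    (z - (v - D) / v * h) ^ 2 / (2 * ((v - D) * D / v))

theorem gaussianPDFReal_mul_exp_gaussExponent {D v : ℝ} (hD : 0 < D) (hv : D < v) (h z : ℝ) :
    gaussianPDFReal 0 (v - D).toNNReal z * Real.exp (gaussExponent D v h z) =
      gaussianPDFReal ((v - D) / v * h) ((v - D) * D / v).toNNReal z := by
  have hV : 0 < v - D := sub_pos.mpr hv
  have hv0 : 0 < v := hD.trans hv
  have hT : 0 < (v - D) * D / v := by positivity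
  simp only [gaussianPDFReal, Real.coe_toNNReal _ hV.le, Real.coe_toNNReal _ hT.le]
  have e1 : Real.exp (gaussExponent D v h z) = √(v / D) *
      Real.exp (z ^ 2 / (2 * (v - D)) -
        (z - (v - D) / v * h) ^ 2 / (2 * ((v - D) * D / v))) := by
    rw [gaussExponent, add_sub_assoc, Real.exp_add, ← Real.log_sqrt (by positivity),
      Real.exp_log (by positivity)]
  have e2 : (√(2 * Real.pi * (v - D)))⁻¹ * √(v / D) = (√(2 * Real.pi * ((v - D) * D / v)))⁻¹ := by
    rw [← Real.sqrt_inv, ← Real.sqrt_inv, ← Real.sqrt_mul (by positivity)]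
    congr 1
    field_simp
  rw [e1, ← e2]
  have e3 : Real.exp (-(z - (v - D) / v * h) ^ 2 / (2 * ((v - D) * D / v))) =
      Real.exp (-(z - 0) ^ 2 / (2 * (v - D))) * Real.exp (z ^ 2 / (2 * (v - D)) -
        (z - (v - D) / v * h) ^ 2 / (2 * ((v - D) * D / v))) := by
    rw [← Real.exp_add]
    congr 1
    ring
  rw [e3]
  ring

theorem lintegral_exp_gaussExponent {D v : ℝ} (hD : 0 < D) (hv : D < v) (h : ℝ) {F : ℝ → ℝ≥0∞}
    (hF : Measurable F) :
    ∫⁻ z, ENNReal.ofReal (Real.exp (gaussExponent D v h z)) * F z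
        ∂gaussianReal 0 (v - D).toNNReal =
      ∫⁻ z, F ((v - D) / v * h + z) ∂gaussianReal 0 ((v - D) * D / v).toNNReal := by
  have hV : 0 < v - D := sub_pos.mpr hv
  have hv0 : 0 < v := hD.trans hv
  have hT : 0 < (v - D) * D / v := by positivity
  have hg : Measurable (gaussExponent D v h) := by unfold gaussExponent; fun_prop
  have hmap : (gaussianReal 0 ((v - D) * D / v).toNNReal).map (fun z => (v - D) / v * h + z) =
      gaussianReal ((v - D) / v * h) ((v - D) * D / v).toNNReal := by
    have := gaussianReal_map_const_add (μ := 0) (v := ((v - D) * D / v).toNNReal) ((v - D) / v * h)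
    simpa using this
  rw [← lintegral_map (f := F) hF (by fun_prop), hmap,
    gaussianReal_of_var_ne_zero _ (by simpa using hV),
    gaussianReal_of_var_ne_zero _ (by simpa using hT),
    lintegral_withDensity_eq_lintegral_mul _ (measurable_gaussianPDF _ _) (by fun_prop),
    lintegral_withDensity_eq_lintegral_mul _ (measurable_gaussianPDF _ _) hF]
  refine lintegral_congr fun z => ?_
  simp only [Pi.mul_apply, gaussianPDF]
  rw [← mul_assoc, ← ENNReal.ofReal_mul (gaussianPDFReal_nonneg _ _ _),
    gaussianPDFReal_mul_exp_gaussExponent hD hv]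

theorem integral_sq_gaussianReal (a b : ℝ) (τ : ℝ≥0) :
    ∫ z, (a + b * z) ^ 2 ∂gaussianReal 0 τ = a ^ 2 + b ^ 2 * τ := by
  have h2 : ∫ z, z ^ 2 ∂gaussianReal 0 τ = τ := by
    have h := variance_fun_id_gaussianReal (μ := 0) (v := τ)
    rw [variance_of_integral_eq_zero (by fun_prop) (by simp)] at h
    exact h
  have hi1 : Integrable (fun z : ℝ => z) (gaussianReal 0 τ) :=
    (memLp_id_gaussianReal 1).integrable le_rfl
  have hi2 : Integrable (fun z : ℝ => z ^ 2) (gaussianReal 0 τ) :=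
    (memLp_id_gaussianReal 2).integrable_sq
  have e : ∀ z : ℝ, (a + b * z) ^ 2 = a ^ 2 + 2 * a * b * z + b ^ 2 * z ^ 2 := fun z => by ring
  simp_rw [e]
  rw [integral_add (f := fun z => a ^ 2 + 2 * a * b * z) ((integrable_const _).add (hi1.const_mul (2 * a * b))) (hi2.const_mul _),
    integral_add (integrable_const _) (hi1.const_mul _), integral_const_mul, integral_const_mul,
    h2, integral_id_gaussianReal]
  simp

/-- The joint law of `(X, Ŝ, Z)` where `Ŝ` is the output of the channel `g` and the Gaussian noise
`Z` is independent of `(X, Ŝ)`. -/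
def channelLaw (A σ : ℝ) (g : ℝ → ℝ) (τ : ℝ≥0) : Measure (ℝ × (Fin 2 × ℝ)) :=
  ((mixLaw A σ).prod (coin.prod (gaussianReal 0 τ))).withDensity
    fun p => ENNReal.ofReal (2 * trans g p.2.1 p.1)

theorem IsChannel.measurable_trans_prod {g : ℝ → ℝ} (hg : IsChannel g) :
    Measurable fun p : ℝ × (Fin 2 × ℝ) => trans g p.2.1 p.1 := by
  have h : Measurable fun q : Fin 2 × ℝ => trans g q.1 q.2 :=
    measurable_from_prod_countable_right fun s => hg.measurable_trans s
  have h2 : Measurable fun p : ℝ × (Fin 2 × ℝ) => (p.2.1, p.1) := by fun_prop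
  exact h.comp h2

theorem measurable_centre (γ : ℝ) : Measurable (centre γ) := measurable_of_countable _

theorem integral_coin (f : Fin 2 → ℝ) : ∫ s, f s ∂coin = (∑ s, f s) / 2 := by
  rw [coin, integral_smul_measure, integral_count]
  simp
  ring

theorem IsChannel.channelLaw_le {g : ℝ → ℝ} (hg : IsChannel g) (τ : ℝ≥0) :
    channelLaw A σ g τ ≤
      (2 : ℝ≥0∞) • ((mixLaw A σ).prod (coin.prod (gaussianReal 0 τ))) := by
  rw [channelLaw, ← withDensity_const]
  refine withDensity_mono (Eventually.of_forall fun p => ?_)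
  calc ENNReal.ofReal (2 * trans g p.2.1 p.1) ≤ ENNReal.ofReal 2 :=
        ENNReal.ofReal_le_ofReal (by linarith [hg.trans_le_one p.2.1 p.1])
    _ = 2 := by simp

theorem IsChannel.memLp_channelLaw {g : ℝ → ℝ} (hg : IsChannel g) {τ : ℝ≥0} {q : ℝ≥0∞}
    {f : ℝ × (Fin 2 × ℝ) → ℝ}
    (hf : MemLp f q ((mixLaw A σ).prod (coin.prod (gaussianReal 0 τ)))) :
    MemLp f q (channelLaw A σ g τ) :=
  (hf.smul_measure (c := 2) (by simp)).mono_measure (hg.channelLaw_le τ)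

theorem IsChannel.integrable_channelLaw_iff {g : ℝ → ℝ} (hg : IsChannel g) {τ : ℝ≥0}
    {f : ℝ × (Fin 2 × ℝ) → ℝ} :
    Integrable f (channelLaw A σ g τ) ↔ Integrable (fun p => 2 * trans g p.2.1 p.1 * f p)
      ((mixLaw A σ).prod (coin.prod (gaussianReal 0 τ))) := by
  have := hg.measurable_trans_prod
  rw [channelLaw, integrable_withDensity_iff_integrable_smul' (by fun_prop)
    (Eventually.of_forall fun _ => ENNReal.ofReal_lt_top)]
  refine iff_of_eq (congrArg (fun F => Integrable F _) (funext fun p => ?_))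
  rw [ENNReal.toReal_ofReal (mul_nonneg zero_le_two (hg.trans_nonneg _ _)), smul_eq_mul]

theorem IsChannel.integral_channelLaw {g : ℝ → ℝ} (hg : IsChannel g) {τ : ℝ≥0}
    {f : ℝ × (Fin 2 × ℝ) → ℝ} (hf : Integrable f (channelLaw A σ g τ)) :
    ∫ p, f p ∂channelLaw A σ g τ =
      ∫ x, ∑ s, trans g s x * ∫ z, f (x, (s, z)) ∂gaussianReal 0 τ ∂mixLaw A σ := by
  have hm := hg.measurable_trans_prod
  have hf' := hg.integrable_channelLaw_iff.mp hf
  have h1 : ∫ p, f p ∂channelLaw A σ g τ = ∫ p, 2 * trans g p.2.1 p.1 * f p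
      ∂((mixLaw A σ).prod (coin.prod (gaussianReal 0 τ))) := by
    rw [channelLaw, integral_withDensity_eq_integral_toReal_smul (by fun_prop)
      (Eventually.of_forall fun _ => ENNReal.ofReal_lt_top)]
    refine integral_congr_ae (Eventually.of_forall fun p => ?_)
    simp only [ENNReal.toReal_ofReal (mul_nonneg zero_le_two (hg.trans_nonneg _ _)), smul_eq_mul]
  rw [h1, integral_prod _ hf']
  refine integral_congr_ae ?_
  filter_upwards [hf'.prod_right_ae] with x hx
  rw [integral_prod _ hx, integral_coin, Finset.sum_div]
  refine Finset.sum_congr rfl fun s _ => ?_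
  simp only [integral_const_mul]
  ring

/-- The reproduction of the test channel: the state `Ŝ` together with the refinement
`(1 - D / v) (X - γ(Ŝ)) + Z` of the observation. -/
def gaussRefine (γ D v : ℝ) (p : ℝ × (Fin 2 × ℝ)) : ℝ × (Fin 2 × ℝ) :=
  (p.1, (p.2.1, (v - D) / v * (p.1 - centre γ p.2.1) + p.2.2))

/-- The transition density of the test channel with respect to a fair coin and an independent
`N(0, v - D)` variable. -/
def gaussRefineDensity (g : ℝ → ℝ) (γ D v : ℝ) (p : ℝ × (Fin 2 × ℝ)) : ℝ≥0∞ :=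
  ENNReal.ofReal (2 * trans g p.2.1 p.1) *
    ENNReal.ofReal (Real.exp (gaussExponent D v (p.1 - centre γ p.2.1) p.2.2))

theorem measurable_gaussRefine (γ D v : ℝ) : Measurable (gaussRefine γ D v) := by
  have := measurable_centre γ
  unfold gaussRefine; fun_prop

theorem IsChannel.measurable_gaussRefineDensity {g : ℝ → ℝ} (hg : IsChannel g) (γ D v : ℝ) :
    Measurable (gaussRefineDensity g γ D v) := by
  have := measurable_centre γ
  have := hg.measurable_trans_prod
  unfold gaussRefineDensity gaussExponent; fun_prop

theorem IsChannel.lintegral_gaussRefineDensity {g : ℝ → ℝ} (hg : IsChannel g) (γ : ℝ) {D v : ℝ}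
    (hD : 0 < D) (hv : D < v) (x : ℝ) :
    ∫⁻ y, gaussRefineDensity g γ D v (x, y) ∂(coin.prod (gaussianReal 0 (v - D).toNNReal)) = 1 := by
  rw [lintegral_prod _ (by
    exact ((hg.measurable_gaussRefineDensity γ D v).comp measurable_prodMk_left).aemeasurable)]
  have h : ∀ s, ∫⁻ z, gaussRefineDensity g γ D v (x, (s, z)) ∂gaussianReal 0 (v - D).toNNReal =
      2 * ENNReal.ofReal (trans g s x) := by
    intro s
    simp only [gaussRefineDensity]
    rw [lintegral_const_mul' _ _ ENNReal.ofReal_ne_top]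
    have := lintegral_exp_gaussExponent hD hv (x - centre γ s) (F := fun _ => 1) measurable_const
    simp only [mul_one, lintegral_const, measure_univ] at this
    rw [this, mul_one, ENNReal.ofReal_mul zero_le_two]
    simp
  simp only [h]
  rw [lintegral_coin, Fin.sum_univ_two, ← mul_add, ← mul_assoc,
    ENNReal.inv_mul_cancel two_ne_zero ENNReal.ofNat_ne_top, one_mul,
    ← ENNReal.ofReal_add (hg.trans_nonneg _ _) (hg.trans_nonneg _ _), trans_zero, trans_one]
  simp

theorem IsChannel.withDensity_gaussRefineDensity {g : ℝ → ℝ} (hg : IsChannel g) (γ : ℝ) {D v : ℝ}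
    (hD : 0 < D) (hv : D < v) :
    ((mixLaw A σ).prod (coin.prod (gaussianReal 0 (v - D).toNNReal))).withDensity
        (gaussRefineDensity g γ D v) =
      (channelLaw A σ g ((v - D) * D / v).toNNReal).map (gaussRefine γ D v) := by
  have hm := hg.measurable_trans_prod
  have hr := measurable_gaussRefine γ D v
  have hd := hg.measurable_gaussRefineDensity γ D v
  refine Measure.ext_of_lintegral _ fun f hf => ?_
  have hfr : Measurable fun p => f (gaussRefine γ D v p) := hf.comp hr
  rw [lintegral_map hf hr, channelLaw, lintegral_withDensity_eq_lintegral_mul _ hd hf,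
    lintegral_withDensity_eq_lintegral_mul _ (by fun_prop) hfr,
    lintegral_prod _ (hd.mul hf).aemeasurable,
    lintegral_prod _ (by fun_prop)]
  refine lintegral_congr fun x => ?_
  rw [lintegral_prod (fun y => (gaussRefineDensity g γ D v * f) (x, y))
      ((hd.mul hf).comp measurable_prodMk_left).aemeasurable,
    lintegral_prod _ (by fun_prop)]
  refine lintegral_congr fun s => ?_
  have hfs : Measurable fun z => f (x, (s, z)) := by fun_prop
  simp only [Pi.mul_apply, gaussRefineDensity, gaussRefine, mul_assoc]
  rw [lintegral_const_mul' _ _ ENNReal.ofReal_ne_top,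
    lintegral_const_mul' _ _ ENNReal.ofReal_ne_top,
    lintegral_exp_gaussExponent hD hv (x - centre γ s) hfs]

theorem memLp_sq_of_four {Ω : Type*} [MeasurableSpace Ω] {μ : Measure Ω} {f : Ω → ℝ}
    (hf : MemLp f 4 μ) : MemLp (fun x => f x ^ 2) 2 μ := by
  have h := hf.norm_rpow_div 2
  have e : (4 : ℝ≥0∞) / 2 = 2 := by
    rw [show (4 : ℝ≥0∞) = 2 * 2 by norm_num, ENNReal.mul_div_cancel_right two_ne_zero
      ENNReal.ofNat_ne_top]
  rw [e] at h
  simpa using h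

theorem memLp_sub_centre (γ : ℝ) (τ : ℝ≥0) (a b : ℝ) :
    MemLp (fun p : ℝ × (Fin 2 × ℝ) => a * (p.1 - centre γ p.2.1) + b * p.2.2) 4
      ((mixLaw A σ).prod (coin.prod (gaussianReal 0 τ))) := by
  have hc := measurable_centre γ
  have h1 : MemLp (fun p : ℝ × (Fin 2 × ℝ) => p.1) 4
      ((mixLaw A σ).prod (coin.prod (gaussianReal 0 τ))) :=
    (memLp_id_mixLaw 4 (by simp)).comp_fst _
  have h2 : MemLp (fun p : ℝ × (Fin 2 × ℝ) => p.2.2) 4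
      ((mixLaw A σ).prod (coin.prod (gaussianReal 0 τ))) :=
    MemLp.comp_snd (f := fun q : Fin 2 × ℝ => q.2)
      (MemLp.comp_snd (memLp_id_gaussianReal' (μ := 0) (v := τ) 4 (by simp)) coin) _
  have h3 : MemLp (fun p : ℝ × (Fin 2 × ℝ) => centre γ p.2.1) 4
      ((mixLaw A σ).prod (coin.prod (gaussianReal 0 τ))) := by
    refine MemLp.of_bound (by fun_prop) |γ| (Eventually.of_forall fun p => ?_)
    rw [Real.norm_eq_abs, centre]
    split_ifs <;> simp
  exact ((h1.sub h3).const_mul a).add (h2.const_mul b)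

theorem IsChannel.memLp_sq_channelLaw {g : ℝ → ℝ} (hg : IsChannel g) (γ : ℝ) (τ : ℝ≥0) (a b : ℝ) :
    MemLp (fun p : ℝ × (Fin 2 × ℝ) => (a * (p.1 - centre γ p.2.1) + b * p.2.2) ^ 2) 2
      (channelLaw A σ g τ) :=
  hg.memLp_channelLaw (memLp_sq_of_four (memLp_sub_centre γ τ a b))

theorem isProbabilityMeasure_channelLaw {g : ℝ → ℝ} (hg : IsChannel g) (τ : ℝ≥0) :
    IsProbabilityMeasure (channelLaw A σ g τ) := by
  have hm := hg.measurable_trans_prod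
  refine ⟨?_⟩
  rw [channelLaw, withDensity_apply _ MeasurableSet.univ, setLIntegral_univ,
    lintegral_prod _ (by exact (hm.const_mul 2).ennreal_ofReal.aemeasurable)]
  have h : ∀ x, ∫⁻ y : Fin 2 × ℝ, ENNReal.ofReal (2 * trans g y.1 x)
      ∂(coin.prod (gaussianReal 0 τ)) = 1 := by
    intro x
    have hmx : Measurable fun y : Fin 2 × ℝ => trans g y.1 x :=
      hm.comp (measurable_prodMk_left (x := x))
    rw [lintegral_prod _ (by fun_prop)]
    simp only [lintegral_const, measure_univ, mul_one]
    rw [lintegral_coin, Fin.sum_univ_two,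
      ← ENNReal.ofReal_add (mul_nonneg zero_le_two (hg.trans_nonneg _ _))
        (mul_nonneg zero_le_two (hg.trans_nonneg _ _)), trans_zero, trans_one,
      show 2 * g x + 2 * (1 - g x) = 2 by ring, ENNReal.ofReal_ofNat,
      ENNReal.inv_mul_cancel two_ne_zero ENNReal.ofNat_ne_top]
  simp only [h]
  simp

theorem sum_trans_mul_const (g : ℝ → ℝ) (x c : ℝ) : ∑ s, trans g s x * c = c := by
  rw [Fin.sum_univ_two, trans_zero, trans_one]; ring

theorem IsChannel.integrable_sq_sub_centre {g : ℝ → ℝ} (hg : IsChannel g) (γ : ℝ) :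
    Integrable (fun x => ∑ s, trans g s x * (x - centre γ s) ^ 2) (mixLaw A σ) := by
  refine integrable_finsetSum _ fun s _ => hg.integrable_mul s ?_
  exact ((memLp_id_mixLaw 2 (by simp)).sub (memLp_const (centre γ s))).integrable_sq

theorem IsChannel.integral_sq_channelLaw (hσ : 0 < σ) {g : ℝ → ℝ} (hg : IsChannel g) (τ : ℝ≥0)
    (a b : ℝ) :
    ∫ p, (a * (p.1 - centre (condMean A σ g) p.2.1) + b * p.2.2) ^ 2 ∂channelLaw A σ g τ =
      a ^ 2 * condVar A σ g + b ^ 2 * τ := by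
  have := isProbabilityMeasure_channelLaw (A := A) (σ := σ) hg τ
  rw [hg.integral_channelLaw ((hg.memLp_sq_channelLaw _ τ a b).integrable one_le_two)]
  simp only [integral_sq_gaussianReal]
  have e : ∀ x, ∑ s, trans g s x * ((a * (x - centre (condMean A σ g) s)) ^ 2 + b ^ 2 * τ) =
      a ^ 2 * (∑ s, trans g s x * (x - centre (condMean A σ g) s) ^ 2) + b ^ 2 * τ := by
    intro x
    rw [← sum_trans_mul_const g x (b ^ 2 * τ), Finset.mul_sum, ← Finset.sum_add_distrib]
    exact Finset.sum_congr rfl fun s _ => by rw [sum_trans_mul_const]; ring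
  simp_rw [e]
  rw [integral_add ((hg.integrable_sq_sub_centre _).const_mul _) (integrable_const _),
    integral_const_mul, hg.integral_sq_sub_centre hσ]
  simp

theorem IsChannel.memLp_log_trans {g : ℝ → ℝ} (hg : IsChannel g) (τ : ℝ≥0) :
    MemLp (fun p : ℝ × (Fin 2 × ℝ) => Real.log (2 * trans g p.2.1 p.1)) 2
      (channelLaw A σ g τ) := by
  have hm := hg.measurable_trans_prod
  have hl : Measurable fun p : ℝ × (Fin 2 × ℝ) => Real.log (2 * trans g p.2.1 p.1) :=
    (hm.const_mul 2).log
  rw [memLp_two_iff_integrable_sq hl.aestronglyMeasurable, hg.integrable_channelLaw_iff]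
  refine Integrable.of_bound (by fun_prop) 4 (Eventually.of_forall fun p => ?_)
  have := hg.trans_nonneg p.2.1 p.1
  rw [Real.norm_of_nonneg (by positivity)]
  exact mul_log_two_mul_sq_le this (hg.trans_le_one _ _)

theorem IsChannel.integral_log_trans {g : ℝ → ℝ} (hg : IsChannel g) (τ : ℝ≥0) :
    ∫ p, Real.log (2 * trans g p.2.1 p.1) ∂channelLaw A σ g τ = info A σ g := by
  have := isProbabilityMeasure_channelLaw (A := A) (σ := σ) hg τ
  rw [hg.integral_channelLaw ((hg.memLp_log_trans τ).integrable one_le_two), info]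
  simp

theorem integral_add_const_add_sub {Ω : Type*} [MeasurableSpace Ω] {μ : Measure Ω}
    [IsProbabilityMeasure μ] {f q r : Ω → ℝ} (hf : Integrable f μ) (hq : Integrable q μ)
    (hr : Integrable r μ) (a b c : ℝ) :
    ∫ x, f x + (c + (a * q x - b * r x)) ∂μ =
      ∫ x, f x ∂μ + (c + (a * ∫ x, q x ∂μ - b * ∫ x, r x ∂μ)) := by
  have h1 := (hq.const_mul a).sub (hr.const_mul b)
  have h2 := (integrable_const (μ := μ) c).add h1
  have e1 := integral_add hf h2
  have e2 := integral_add (integrable_const (μ := μ) c) h1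
  have e3 := integral_sub (hq.const_mul a) (hr.const_mul b)
  simp only [Pi.add_apply, Pi.sub_apply, integral_const_mul, integral_const, probReal_univ,
    one_smul] at e1 e2 e3
  rw [e1, e2, e3]

/-- The information density of the test channel with a Gaussian refinement. Where a transition
probability vanishes, the convention `log 0 = 0` is harmless: the density is zero there, and only
the bound `gaussRefineDensity_le` is needed. -/
def refineInfo (g : ℝ → ℝ) (γ D v : ℝ) (p : ℝ × (Fin 2 × ℝ)) : ℝ :=
  Real.log (2 * trans g p.2.1 p.1) + gaussExponent D v (p.1 - centre γ p.2.1) p.2.2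

theorem IsChannel.measurable_refineInfo {g : ℝ → ℝ} (hg : IsChannel g) (γ D v : ℝ) :
    Measurable (refineInfo g γ D v) := by
  have hc := measurable_centre γ
  have hm := hg.measurable_trans_prod
  unfold refineInfo gaussExponent
  exact (hm.const_mul 2).log.add (by fun_prop)

theorem IsChannel.gaussRefineDensity_le {g : ℝ → ℝ} (hg : IsChannel g) (γ D v : ℝ)
    (p : ℝ × (Fin 2 × ℝ)) :
    gaussRefineDensity g γ D v p ≤ ENNReal.ofReal (Real.exp (refineInfo g γ D v p)) := by
  rw [gaussRefineDensity, ← ENNReal.ofReal_mul (mul_nonneg zero_le_two (hg.trans_nonneg _ _)),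
    refineInfo, Real.exp_add]
  exact ENNReal.ofReal_le_ofReal (mul_le_mul_of_nonneg_right (Real.le_exp_log _)
    (Real.exp_pos _).le)

theorem refineInfo_gaussRefine (g : ℝ → ℝ) (γ D v : ℝ) (p : ℝ × (Fin 2 × ℝ)) :
    refineInfo g γ D v (gaussRefine γ D v p) =
      Real.log (2 * trans g p.2.1 p.1) + (Real.log (v / D) / 2 +
        ((1 / (2 * (v - D))) * ((v - D) / v * (p.1 - centre γ p.2.1) + 1 * p.2.2) ^ 2 -
        (1 / (2 * ((v - D) * D / v))) * (0 * (p.1 - centre γ p.2.1) + 1 * p.2.2) ^ 2)) := by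
  simp only [refineInfo, gaussRefine, gaussExponent]
  ring

theorem IsChannel.memLp_refineInfo {g : ℝ → ℝ} (hg : IsChannel g) (γ D v : ℝ) (τ : ℝ≥0) :
    MemLp (fun p => refineInfo g γ D v (gaussRefine γ D v p)) 2 (channelLaw A σ g τ) := by
  have hP := isProbabilityMeasure_channelLaw (A := A) (σ := σ) hg τ
  simp only [refineInfo_gaussRefine]
  have h1 := (hg.memLp_sq_channelLaw (A := A) (σ := σ) γ τ ((v - D) / v) 1).const_mul
    (1 / (2 * (v - D)))
  have h2 := (hg.memLp_sq_channelLaw (A := A) (σ := σ) γ τ 0 1).const_mul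
    (1 / (2 * ((v - D) * D / v)))
  have h3 := (memLp_const (p := 2) (μ := channelLaw A σ g τ) (Real.log (v / D) / 2)).add
    (h1.sub h2)
  exact (hg.memLp_log_trans τ).add h3

/-- The refinement costs at most `½ log (v / D)` nats. -/
theorem IsChannel.integral_refineInfo_le (hσ : 0 < σ) {g : ℝ → ℝ} (hg : IsChannel g) {D v : ℝ}
    (hD : 0 < D) (hv : D < v) (hcv : condVar A σ g ≤ v) :
    ∫ p, refineInfo g (condMean A σ g) D v (gaussRefine (condMean A σ g) D v p)
      ∂channelLaw A σ g ((v - D) * D / v).toNNReal ≤ info A σ g + Real.log (v / D) / 2 := by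
  have hV : 0 < v - D := sub_pos.mpr hv
  have hv0 : 0 < v := hD.trans hv
  have hT : 0 < (v - D) * D / v := by positivity
  set τ := ((v - D) * D / v).toNNReal with hτ
  have hτr : (τ : ℝ) = (v - D) * D / v := Real.coe_toNNReal _ hT.le
  have hP := isProbabilityMeasure_channelLaw (A := A) (σ := σ) hg τ
  simp only [refineInfo_gaussRefine]
  rw [integral_add_const_add_sub ((hg.memLp_log_trans τ).integrable one_le_two)
    ((hg.memLp_sq_channelLaw _ τ _ _).integrable one_le_two)
    ((hg.memLp_sq_channelLaw _ τ _ _).integrable one_le_two),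
    hg.integral_sq_channelLaw hσ, hg.integral_sq_channelLaw hσ, hg.integral_log_trans, hτr]
  have e : 1 / (2 * (v - D)) * (((v - D) / v) ^ 2 * condVar A σ g + 1 ^ 2 * ((v - D) * D / v)) -
      1 / (2 * ((v - D) * D / v)) * (0 ^ 2 * condVar A σ g + 1 ^ 2 * ((v - D) * D / v)) =
      (v - D) / (2 * v ^ 2) * (condVar A σ g - v) := by
    field_simp
    ring
  have : (v - D) / (2 * v ^ 2) * (condVar A σ g - v) ≤ 0 :=
    mul_nonpos_of_nonneg_of_nonpos (by positivity) (sub_nonpos.mpr hcv)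
  rw [e]
  linarith

/-- The two single-letter distortions of the reproduction `(s, z)`, which stands for the state `s`
and the observation `γ(s) + z`: the posterior error probability and the squared error. -/
def refineDist (A σ γ : ℝ) (k : Fin 2) (p : ℝ × (Fin 2 × ℝ)) : ℝ :=
  if k = 0 then errProb A σ p.2.1 p.1 else (p.1 - (centre γ p.2.1 + p.2.2)) ^ 2

theorem measurable_errProb_prod :
    Measurable fun p : ℝ × (Fin 2 × ℝ) => errProb A σ p.2.1 p.1 := by
  have h : Measurable fun q : Fin 2 × ℝ => errProb A σ q.1 q.2 :=
    measurable_from_prod_countable_right fun s => measurable_errProb s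
  exact h.comp (by fun_prop : Measurable fun p : ℝ × (Fin 2 × ℝ) => (p.2.1, p.1))

theorem measurable_refineDist (γ : ℝ) (k : Fin 2) : Measurable (refineDist A σ γ k) := by
  have hc := measurable_centre γ
  unfold refineDist
  split_ifs
  · exact measurable_errProb_prod
  · fun_prop

theorem refineDist_nonneg (hσ : 0 < σ) (γ : ℝ) (k : Fin 2) (p : ℝ × (Fin 2 × ℝ)) :
    0 ≤ refineDist A σ γ k p := by
  unfold refineDist
  split_ifs
  exacts [errProb_nonneg hσ _ _, sq_nonneg _]

theorem refineDist_zero_gaussRefine (γ D v : ℝ) (p : ℝ × (Fin 2 × ℝ)) :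
    refineDist A σ γ 0 (gaussRefine γ D v p) = errProb A σ p.2.1 p.1 := rfl

theorem refineDist_one_gaussRefine (γ D : ℝ) {v : ℝ} (hv : v ≠ 0) (p : ℝ × (Fin 2 × ℝ)) :
    refineDist A σ γ 1 (gaussRefine γ D v p) =
      (D / v * (p.1 - centre γ p.2.1) + (-1) * p.2.2) ^ 2 := by
  simp only [refineDist, gaussRefine, one_ne_zero, if_false]
  field_simp
  ring

theorem memLp_errProb (hσ : 0 < σ) (q : ℝ≥0∞) (μ : Measure (ℝ × (Fin 2 × ℝ)))
    [IsFiniteMeasure μ] : MemLp (fun p => errProb A σ p.2.1 p.1) q μ :=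
  MemLp.of_bound measurable_errProb_prod.aestronglyMeasurable 1 (Eventually.of_forall fun p => by
    rw [Real.norm_of_nonneg (errProb_nonneg hσ _ _)]; exact errProb_le_one hσ _ _)

theorem IsChannel.memLp_refineDist (hσ : 0 < σ) {g : ℝ → ℝ} (hg : IsChannel g) (γ D : ℝ) {v : ℝ}
    (hv : v ≠ 0) (τ : ℝ≥0) (k : Fin 2) :
    MemLp (fun p => refineDist A σ γ k (gaussRefine γ D v p)) 2 (channelLaw A σ g τ) := by
  have hP := isProbabilityMeasure_channelLaw (A := A) (σ := σ) hg τ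
  fin_cases k
  · exact memLp_errProb hσ 2 _
  · change MemLp (fun p => refineDist A σ γ 1 (gaussRefine γ D v p)) 2 (channelLaw A σ g τ)
    simp only [refineDist_one_gaussRefine γ D hv]
    exact hg.memLp_sq_channelLaw γ τ _ _

theorem IsChannel.integral_refineDist_zero (hσ : 0 < σ) {g : ℝ → ℝ} (hg : IsChannel g)
    (γ D v : ℝ) (τ : ℝ≥0) :
    ∫ p, refineDist A σ γ 0 (gaussRefine γ D v p) ∂channelLaw A σ g τ = semDist A σ g := by
  have hP := isProbabilityMeasure_channelLaw (A := A) (σ := σ) hg τ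
  simp only [refineDist_zero_gaussRefine]
  rw [hg.integral_channelLaw ((memLp_errProb hσ 1 _).integrable le_rfl), ← hg.integral_errProb hσ]
  simp

theorem IsChannel.integral_refineDist_one_le (hσ : 0 < σ) {g : ℝ → ℝ} (hg : IsChannel g) {D v : ℝ}
    (hD : 0 < D) (hv : D < v) (hcv : condVar A σ g ≤ v) :
    ∫ p, refineDist A σ (condMean A σ g) 1 (gaussRefine (condMean A σ g) D v p)
      ∂channelLaw A σ g ((v - D) * D / v).toNNReal ≤ D := by
  have hV : 0 < v - D := sub_pos.mpr hv
  have hv0 : 0 < v := hD.trans hv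
  have hT : 0 < (v - D) * D / v := by positivity
  simp only [refineDist_one_gaussRefine _ D hv0.ne']
  rw [hg.integral_sq_channelLaw hσ, Real.coe_toNNReal _ hT.le]
  have : (D / v) ^ 2 * condVar A σ g ≤ (D / v) ^ 2 * v :=
    mul_le_mul_of_nonneg_left hcv (by positivity)
  have e : (D / v) ^ 2 * v + (-1) ^ 2 * ((v - D) * D / v) = D := by
    field_simp
    ring
  linarith

theorem memLp_refineDist_fallback (hσ : 0 < σ) (γ : ℝ) (k : Fin 2) :
    MemLp (fun x => refineDist A σ γ k (x, ((0 : Fin 2), (0 : ℝ)))) 2 (mixLaw A σ) := by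
  fin_cases k
  · exact MemLp.of_bound (measurable_errProb 0).aestronglyMeasurable 1
      (Eventually.of_forall fun p => by
        change ‖errProb A σ 0 p‖ ≤ 1
        rw [Real.norm_of_nonneg (errProb_nonneg hσ _ _)]; exact errProb_le_one hσ _ _)
  · exact memLp_sq_of_four ((memLp_id_mixLaw 4 (by simp)).sub (memLp_const (centre γ 0 + 0)))

/-- Direct part: the test channel made of `g` and of a Gaussian refinement designed for a variance
`v` which is at least the conditional variance of `X`. -/
theorem IsChannel.achievable (hσ : 0 < σ) {g : ℝ → ℝ} (hg : IsChannel g) {D v : ℝ} (hD : 0 < D)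
    (hv : D < v) (hcv : condVar A σ g ≤ v) {R : ℝ≥0} (hR0 : 0 < R)
    (hR : info A σ g + Real.log (v / D) / 2 < R * Real.log 2) :
    Achievable (source A σ) hammingDistortion squaredError R (ENNReal.ofReal (semDist A σ g))
      (ENNReal.ofReal D) := by
  have hv0 : 0 < v := hD.trans hv
  have hιI := hg.integral_refineInfo_le (A := A) hσ hD hv hcv
  have hdI1 := hg.integral_refineDist_one_le (A := A) hσ hD hv hcv
  set γ := condMean A σ g with hγ
  set τ := ((v - D) * D / v).toNNReal with hτ
  have hr := measurable_gaussRefine γ D v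
  have hdm := measurable_refineDist (A := A) (σ := σ) γ
  have hιm := hg.measurable_refineInfo γ D v
  have hJ := hg.withDensity_gaussRefineDensity (A := A) (σ := σ) γ hD hv
  have hP := isProbabilityMeasure_channelLaw (A := A) (σ := σ) hg τ
  have hP' : IsProbabilityMeasure (((mixLaw A σ).prod (coin.prod (gaussianReal 0
      (v - D).toNNReal))).withDensity (gaussRefineDensity g γ D v)) := by
    rw [hJ]; exact Measure.isProbabilityMeasure_map hr.aemeasurable
  have hdI0 := hg.integral_refineDist_zero (A := A) hσ γ D v τ
  have hcode := fun (ε : ℝ) (hε : 0 < ε) => eventually_exists_code (κ := Fin 2) (mixLaw A σ)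
    (coin.prod (gaussianReal 0 (v - D).toNNReal)) (gaussRefineDensity g γ D v)
    (hg.measurable_gaussRefineDensity γ D v) (hg.lintegral_gaussRefineDensity γ hD hv)
    (refineInfo g γ D v) hιm (hg.gaussRefineDensity_le γ D v)
    (by
      rw [hJ, memLp_map_measure_iff hιm.aestronglyMeasurable hr.aemeasurable]
      exact hg.memLp_refineInfo γ D v τ)
    (refineDist A σ γ) hdm (refineDist_nonneg hσ γ)
    (fun k => by
      rw [hJ, memLp_map_measure_iff (hdm k).aestronglyMeasurable hr.aemeasurable]
      exact hg.memLp_refineDist hσ γ D hv0.ne' τ k)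
    (0, 0) (memLp_refineDist_fallback hσ γ) hR0
    (by rw [hJ, integral_map hr.aemeasurable hιm.aestronglyMeasurable]; exact hιI.trans_lt hR) hε
  have hdI : ∀ k, ∫ p, refineDist A σ γ k p ∂(((mixLaw A σ).prod (coin.prod (gaussianReal 0
      (v - D).toNNReal))).withDensity (gaussRefineDensity g γ D v)) =
      ∫ p, refineDist A σ γ k (gaussRefine γ D v p) ∂channelLaw A σ g τ := fun k => by
    rw [hJ, integral_map hr.aemeasurable (hdm k).aestronglyMeasurable]
  have hsem : 0 ≤ semDist A σ g := by
    rw [← hdI0]; exact integral_nonneg fun p => refineDist_nonneg hσ _ _ _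
  refine achievable_of_eventually _ _ _ _ _ _ fun ε hε => ?_
  filter_upwards [hcode ε hε, eventually_ne_atTop 0] with n hn hn0
  obtain ⟨f, hf, c, hfc⟩ := hn
  refine ⟨f, hf, fun j => (fun i => (c j i).1, fun i => centre γ (c j i).1 + (c j i).2), ?_, ?_⟩
  · have h := hfc 0
    rw [hdI, hdI0, ENNReal.ofReal_add hsem hε.le] at h
    refine le_trans (le_of_eq ?_) h
    exact lintegral_blockDistortion_hamming hσ hn0 (fun x i => (c (f x) i).1) fun i =>
      (measurable_of_countable fun j => (c j i).1).comp hf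
  · have h := hfc 1
    rw [hdI] at h
    refine le_trans (le_of_eq ?_) (h.trans ((ENNReal.ofReal_le_ofReal
      (add_le_add hdI1 le_rfl)).trans (ENNReal.ofReal_add hD.le hε.le).le))
    have hci : ∀ i, Measurable fun x => c (f x) i := fun i =>
      (measurable_of_countable fun j => c j i).comp hf
    have hi : ∀ i, Measurable fun x : Fin n → ℝ =>
        ENNReal.ofReal (refineDist A σ γ 1 (x i, c (f x) i)) := fun i => by
      have := (hdm 1).comp ((measurable_pi_apply i).prodMk (hci i))
      simpa only [Function.comp_def] using this.ennreal_ofReal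
    have hF : Measurable fun x : Fin n → ℝ =>
        (∑ i, ENNReal.ofReal (refineDist A σ γ 1 (x i, c (f x) i))) / (n : ℝ≥0∞) :=
      (Finset.measurable_sum _ fun i _ => hi i).div_const _
    rw [← lintegral_pi_source_snd hσ hn0 _ hF]
    refine lintegral_congr fun z => ?_
    rw [coe_blockDistortion _ hn0]
    rfl

theorem IsChannel.condVar_nonneg (hσ : 0 < σ) {g : ℝ → ℝ} (hg : IsChannel g) :
    0 ≤ condVar A σ g := by
  rw [← hg.integral_sq_sub_centre hσ]
  exact integral_nonneg fun x => Finset.sum_nonneg fun s _ =>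
    mul_nonneg (hg.trans_nonneg s x) (sq_nonneg _)

theorem logb_max_div {c D : ℝ} (hc : 0 ≤ c) (hD : 0 < D) :
    Real.logb 2 (max c D / D) = max (Real.logb 2 (c / D)) 0 := by
  rcases le_total c D with h | h
  · rw [max_eq_right h, div_self hD.ne', Real.logb_one, max_eq_right]
    exact Real.logb_nonpos one_lt_two (by positivity) ((div_le_one hD).mpr h)
  · rw [max_eq_left h, max_eq_left]
    exact Real.logb_nonneg one_lt_two ((one_le_div hD).mpr h)

/-- The rate `I(X; Ŝ) + ½ (log₂ (η / D))⁺` is sufficient, for the conditional variance `η`. -/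
theorem IsChannel.sordf_le (hσ : 0 < σ) {g : ℝ → ℝ} (hg : IsChannel g) {D : ℝ} (hD : 0 < D) :
    sordf A σ (ENNReal.ofReal (semDist A σ g)) (ENNReal.ofReal D) ≤
      ENNReal.ofReal (info A σ g / Real.log 2 +
        1 / 2 * max (Real.logb 2 (condVar A σ g / D)) 0) := by
  have hl : 0 < Real.log 2 := Real.log_pos one_lt_two
  have h1 : ∀ v ∈ Ioi (max (condVar A σ g) D),
      sordf A σ (ENNReal.ofReal (semDist A σ g)) (ENNReal.ofReal D) ≤
        ENNReal.ofReal (info A σ g / Real.log 2 + 1 / 2 * Real.logb 2 (v / D)) := by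
    intro v hv
    obtain ⟨hv1, hv2⟩ := max_lt_iff.mp (mem_Ioi.mp hv)
    refine le_of_forall_gt fun c hc => ?_
    obtain ⟨R, hR1, hR2⟩ := ENNReal.lt_iff_exists_nnreal_btwn.mp hc
    refine lt_of_le_of_lt ?_ hR2
    have hR0 : 0 < R := by
      have : (0 : ℝ≥0∞) < R := lt_of_le_of_lt zero_le hR1
      exact_mod_cast this
    have hR3 : info A σ g / Real.log 2 + 1 / 2 * Real.logb 2 (v / D) < R := by
      rw [← ENNReal.ofReal_coe_nnreal] at hR1
      exact ((ENNReal.ofReal_lt_ofReal_iff (by exact_mod_cast hR0)).mp hR1)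
    refine iInf₂_le R (hg.achievable hσ hD hv2 hv1.le hR0 ?_)
    have := mul_lt_mul_of_pos_right hR3 hl
    rw [Real.logb] at this
    refine lt_of_eq_of_lt ?_ this
    field_simp
  have h2 : Tendsto (fun v => ENNReal.ofReal (info A σ g / Real.log 2 +
      1 / 2 * Real.logb 2 (v / D))) (𝓝[>] (max (condVar A σ g) D))
      (𝓝 (ENNReal.ofReal (info A σ g / Real.log 2 +
        1 / 2 * Real.logb 2 (max (condVar A σ g) D / D)))) := by
    have hm : 0 < max (condVar A σ g) D := lt_max_of_lt_right hD
    refine ENNReal.tendsto_ofReal (tendsto_const_nhds.add (Tendsto.const_mul _ ?_))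
    refine Tendsto.mono_left ?_ nhdsWithin_le_nhds
    simp only [Real.logb]
    refine Tendsto.div_const (Tendsto.log ?_ (by positivity)) _
    exact (continuous_id.div_const D).tendsto _
  rw [← logb_max_div (hg.condVar_nonneg hσ) hD]
  exact ge_of_tendsto h2 (eventually_nhdsWithin_of_forall h1)

/-! ### The converse -/

theorem IsChannel.integral_trans (hσ : 0 < σ) {g : ℝ → ℝ} (hg : IsChannel g) (s : Fin 2) :
    ∫ x, trans g s x ∂mixLaw A σ = 1 / 2 := by
  have hi : ∀ s, Integrable (trans g s) (mixLaw A σ) := fun s => by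
    simpa using hg.integrable_mul s (integrable_const (μ := mixLaw A σ) (1 : ℝ))
  have h1 : ∫ x, trans g 1 x ∂mixLaw A σ = ∫ x, trans g 0 x ∂mixLaw A σ := by
    rw [← integral_mixLaw_neg hσ]
    simp only [hg.trans_neg]
  have h2 : ∫ x, trans g 0 x ∂mixLaw A σ + ∫ x, trans g 1 x ∂mixLaw A σ = 1 := by
    rw [← integral_add (hi 0) (hi 1)]
    simp [trans_zero, trans_one]
  fin_cases s
  · change ∫ x, trans g 0 x ∂mixLaw A σ = 1 / 2
    linarith
  · change ∫ x, trans g 1 x ∂mixLaw A σ = 1 / 2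
    linarith

/-- For any reproduction chosen from a codebook of `M` words, the expected tilted information
`∑ log (2 P(ŝᵢ | xᵢ))` is at most `log M`: for each fixed word its exponential has mean one. -/
theorem IsChannel.integral_sum_log_le (hσ : 0 < σ) {g : ℝ → ℝ} (hg : IsChannel g)
    (hpos : ∀ s x, 0 < trans g s x) {n M : ℕ} (hM : 0 < M) (f : (Fin n → ℝ) → Fin M)
    (y : Fin M → Fin n → Fin 2)
    (hi : Integrable (fun x : Fin n → ℝ => ∑ i, Real.log (2 * trans g (y (f x) i) (x i)))
      (Measure.pi fun _ => mixLaw A σ)) :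
    ∫ x, ∑ i, Real.log (2 * trans g (y (f x) i) (x i)) ∂(Measure.pi fun _ : Fin n => mixLaw A σ) ≤
      Real.log M := by
  set μ := Measure.pi fun _ : Fin n => mixLaw A σ with hμ
  have hM' : (0 : ℝ) < M := by exact_mod_cast hM
  have hint : ∀ j, Integrable (fun x : Fin n → ℝ => ∏ i, (2 * trans g (y j i) (x i))) μ := by
    intro j
    refine Integrable.fintype_prod (f := fun i a => 2 * trans g (y j i) a) fun i => ?_
    have := hg.integrable_mul (y j i) (integrable_const (μ := mixLaw A σ) (2 : ℝ))
    simpa only [mul_comm] using this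
  have hone : ∀ j, ∫ x : Fin n → ℝ, ∏ i, (2 * trans g (y j i) (x i)) ∂μ = 1 := by
    intro j
    rw [hμ, integral_fintype_prod_eq_prod (fun i a => 2 * trans g (y j i) a)]
    simp [integral_const_mul, hg.integral_trans hσ]
  have hpt : ∀ x : Fin n → ℝ, ∑ i, Real.log (2 * trans g (y (f x) i) (x i)) ≤
      (∑ j, ∏ i, (2 * trans g (y j i) (x i))) / M + (Real.log M - 1) := by
    intro x
    have hp : ∀ j, 0 < ∏ i, (2 * trans g (y j i) (x i)) := fun j =>
      Finset.prod_pos fun i _ => mul_pos two_pos (hpos _ _)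
    rw [← Real.log_prod fun i _ => (mul_pos two_pos (hpos _ _)).ne']
    have h1 := Real.log_le_sub_one_of_pos (div_pos (hp (f x)) hM')
    rw [Real.log_div (hp _).ne' hM'.ne'] at h1
    have h2 : (∏ i, (2 * trans g (y (f x) i) (x i))) / M ≤
        (∑ j, ∏ i, (2 * trans g (y j i) (x i))) / M :=
      div_le_div_of_nonneg_right (Finset.single_le_sum
        (f := fun j => ∏ i, (2 * trans g (y j i) (x i))) (fun j _ => (hp j).le)
        (Finset.mem_univ (f x))) hM'.le
    linarith
  have hint2 := (integrable_finsetSum Finset.univ fun j _ => hint j).div_const (M : ℝ)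
  refine (integral_mono hi (hint2.add (integrable_const (Real.log M - 1))) hpt).trans ?_
  have e := integral_add hint2 (integrable_const (μ := μ) (Real.log M - 1))
  refine (le_of_eq e).trans ?_
  rw [integral_div, integral_finsetSum _ fun j _ => hint j]
  simp only [hone]
  simp [hM'.ne']

/-- The dual bound on the rate: if `log (2 P(Ŝ = t | X = x)) = ψ(x) - s P(S ≠ t | X = x)` for the
test channel `g`, then every achievable pair satisfies `R log 2 ≥ E ψ(X) - s D`. -/
theorem IsChannel.le_rate_of_achievable (hσ : 0 < σ) {g : ℝ → ℝ} (hg : IsChannel g)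
    (hpos : ∀ s x, 0 < trans g s x) {s C : ℝ} (hs : 0 ≤ s) {ψ : ℝ → ℝ} (hψm : Measurable ψ)
    (hψC : ∀ x, |ψ x| ≤ C)
    (hψ : ∀ t x, Real.log (2 * trans g t x) = ψ x - s * errProb A σ t x) {R : ℝ≥0} {D : ℝ}
    (hD : 0 ≤ D) (h : Achievable (source A σ) hammingDistortion squaredError R
      (ENNReal.ofReal D) ∞) :
    ∫ x, ψ x ∂mixLaw A σ - s * D ≤ R * Real.log 2 := by
  obtain ⟨f, dec, hf, hlim, -⟩ := h
  refine le_of_forall_pos_le_add fun δ hδ => ?_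
  set ε := δ / (s + 1) with hε
  have hε0 : 0 < ε := by positivity
  have hsε : s * ε ≤ δ := by
    rw [hε, mul_div_assoc', div_le_iff₀ (by positivity)]
    nlinarith
  have hlt : ENNReal.ofReal D < ENNReal.ofReal (D + ε) :=
    (ENNReal.ofReal_lt_ofReal_iff (by positivity)).mpr (by linarith)
  obtain ⟨n, hn, hn0⟩ :=
    ((eventually_lt_of_limsup_lt (hlim.trans_lt hlt)).and (eventually_ne_atTop 0)).exists
  have hn' : (0 : ℝ) < n := by exact_mod_cast Nat.pos_of_ne_zero hn0
  set μ := Measure.pi fun _ : Fin n => mixLaw A σ with hμ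
  set y : Fin (codebookSize R n) → Fin n → Fin 2 := fun j => (dec n j).1 with hy
  have hym : ∀ i, Measurable fun x => y (f n x) i := fun i =>
    (measurable_of_countable fun j => y j i).comp (hf n)
  have hem : Measurable fun q : Fin 2 × ℝ => errProb A σ q.1 q.2 :=
    measurable_from_prod_countable_right fun s => measurable_errProb s
  have hei : ∀ i, Integrable (fun x : Fin n → ℝ => errProb A σ (y (f n x) i) (x i)) μ := by
    intro i
    have hm : Measurable fun x : Fin n → ℝ => errProb A σ (y (f n x) i) (x i) := by
      have := hem.comp ((hym i).prodMk (measurable_pi_apply i))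
      simpa only [Function.comp_def] using this
    refine Integrable.of_bound hm.aestronglyMeasurable 1 (Eventually.of_forall fun x => ?_)
    rw [Real.norm_of_nonneg (errProb_nonneg hσ _ _)]
    exact errProb_le_one hσ _ _
  have hψi : Integrable ψ (mixLaw A σ) :=
    Integrable.of_bound hψm.aestronglyMeasurable C (Eventually.of_forall hψC)
  have hψi' : ∀ i, Integrable (fun x : Fin n → ℝ => ψ (x i)) μ := fun i =>
    (measurePreserving_eval (fun _ : Fin n => mixLaw A σ) i).integrable_comp_of_integrable hψi
  have hψe : ∀ i, ∫ x : Fin n → ℝ, ψ (x i) ∂μ = ∫ x, ψ x ∂mixLaw A σ := by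
    intro i
    have hp := measurePreserving_eval (fun _ : Fin n => mixLaw A σ) i
    conv_rhs => rw [← hp.map_eq]
    rw [integral_map hp.measurable.aemeasurable hψm.aestronglyMeasurable]
  have hsum : ∀ x : Fin n → ℝ, ∑ i, Real.log (2 * trans g (y (f n x) i) (x i)) =
      ∑ i, ψ (x i) - s * ∑ i, errProb A σ (y (f n x) i) (x i) := by
    intro x
    simp only [hψ, Finset.sum_sub_distrib, Finset.mul_sum]
  have hdi : Integrable (fun x : Fin n → ℝ => ∑ i, errProb A σ (y (f n x) i) (x i)) μ :=
    integrable_finsetSum _ fun i _ => hei i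
  have hsi : Integrable (fun x : Fin n → ℝ => ∑ i, ψ (x i)) μ :=
    integrable_finsetSum _ fun i _ => hψi' i
  have hlog := hg.integral_sum_log_le (A := A) hσ hpos (codebookSize_pos R n) (f n) y (by
    simp only [hsum]; exact hsi.sub (hdi.const_mul s))
  simp only [hsum] at hlog
  rw [integral_sub hsi (hdi.const_mul s), integral_const_mul,
    integral_finsetSum _ fun i _ => hψi' i] at hlog
  simp only [hψe, Finset.sum_const, Finset.card_univ, Fintype.card_fin, nsmul_eq_mul] at hlog
  -- the semantic distortion of the code at block length `n`
  have hdist : ∫ x : Fin n → ℝ, ∑ i, errProb A σ (y (f n x) i) (x i) ∂μ ≤ n * (D + ε) := by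
    have e := lintegral_blockDistortion_hamming (A := A) hσ hn0 (fun x i => y (f n x) i) hym
    have hn1 := hn.le
    rw [e] at hn1
    have e2 : ∀ x : Fin n → ℝ, (∑ i, ENNReal.ofReal (errProb A σ (y (f n x) i) (x i))) / n =
        ENNReal.ofReal ((∑ i, errProb A σ (y (f n x) i) (x i)) / n) := by
      intro x
      rw [ENNReal.ofReal_div_of_pos hn', ENNReal.ofReal_sum_of_nonneg fun i _ =>
        errProb_nonneg hσ _ _, ENNReal.ofReal_natCast]
    simp only [e2] at hn1
    rw [← ofReal_integral_eq_lintegral_ofReal (hdi.div_const _) (Eventually.of_forall fun x =>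
      div_nonneg (Finset.sum_nonneg fun i _ => errProb_nonneg hσ _ _) hn'.le),
      ENNReal.ofReal_le_ofReal_iff (by positivity), integral_div, div_le_iff₀ hn'] at hn1
    linarith
  have hcb : Real.log (codebookSize R n) ≤ n * (R * Real.log 2) := by
    have h1 : (0 : ℝ) < codebookSize R n := by exact_mod_cast codebookSize_pos R n
    rw [← Real.log_exp (n * (R * Real.log 2))]
    exact Real.log_le_log h1 (codebookSize_le R n)
  have hfin : n * (∫ x, ψ x ∂mixLaw A σ - s * D) ≤ n * (R * Real.log 2 + δ) := by
    have h3 := mul_le_mul_of_nonneg_left hdist hs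
    have h4 : (n : ℝ) * (s * ε) ≤ n * δ := mul_le_mul_of_nonneg_left hsε hn'.le
    nlinarith
  exact le_of_mul_le_mul_left hfin hn'

/-- If the test channel meets the distortion level with equality, then the dual bound is its
mutual information. -/
theorem IsChannel.info_le_of_achievable (hσ : 0 < σ) {g : ℝ → ℝ} (hg : IsChannel g)
    (hpos : ∀ s x, 0 < trans g s x) {s C : ℝ} (hs : 0 ≤ s) {ψ : ℝ → ℝ} (hψm : Measurable ψ)
    (hψC : ∀ x, |ψ x| ≤ C)
    (hψ : ∀ t x, Real.log (2 * trans g t x) = ψ x - s * errProb A σ t x) {R : ℝ≥0}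
    (h : Achievable (source A σ) hammingDistortion squaredError R
      (ENNReal.ofReal (semDist A σ g)) ∞) :
    info A σ g ≤ R * Real.log 2 := by
  have hψi : Integrable ψ (mixLaw A σ) :=
    Integrable.of_bound hψm.aestronglyMeasurable C (Eventually.of_forall hψC)
  have hei : Integrable (fun x => ∑ t, trans g t x * errProb A σ t x) (mixLaw A σ) := by
    refine integrable_finsetSum _ fun t _ => hg.integrable_mul t ?_
    refine Integrable.of_bound (measurable_errProb t).aestronglyMeasurable 1
      (Eventually.of_forall fun x => ?_)
    rw [Real.norm_of_nonneg (errProb_nonneg hσ _ _)]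
    exact errProb_le_one hσ _ _
  have hsem : 0 ≤ semDist A σ g := by
    rw [← hg.integral_errProb hσ]
    exact integral_nonneg fun x => Finset.sum_nonneg fun t _ =>
      mul_nonneg (hg.trans_nonneg t x) (errProb_nonneg hσ t x)
  have e : info A σ g = ∫ x, ψ x ∂mixLaw A σ - s * semDist A σ g := by
    rw [← hg.integral_errProb hσ, ← integral_const_mul, ← integral_sub hψi (hei.const_mul s), info]
    refine integral_congr_ae (Eventually.of_forall fun x => ?_)
    simp only [hψ, mul_sub, Finset.sum_sub_distrib, sum_trans_mul_const, Finset.mul_sum]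
    congr 1
    exact Finset.sum_congr rfl fun t _ => by ring
  rw [e]
  exact hg.le_rate_of_achievable hσ hpos hs hψm hψC hψ hsem h

/-! ### The family of optimal channels -/

/-- The posterior bias `P(S = 0 | X = x) - P(S = 1 | X = x)`. -/
def bias (A σ x : ℝ) : ℝ :=
  (1 - Real.exp (-2 * A * x / σ ^ 2)) / (1 + Real.exp (-2 * A * x / σ ^ 2))

theorem testChannel_eq (lam x : ℝ) :
    testChannel A σ lam x = (1 + Real.exp (lam * bias A σ x))⁻¹ := rfl

@[fun_prop]
theorem measurable_bias : Measurable (bias A σ) := by unfold bias; fun_prop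

theorem bias_neg (x : ℝ) : bias A σ (-x) = -bias A σ x := by
  unfold bias
  have e : Real.exp (-2 * A * -x / σ ^ 2) = (Real.exp (-2 * A * x / σ ^ 2))⁻¹ := by
    rw [← Real.exp_neg]; congr 1; ring
  have := Real.exp_pos (-2 * A * x / σ ^ 2)
  rw [e]
  field_simp
  ring

theorem densNeg_eq (hσ : 0 < σ) (x : ℝ) :
    densNeg A σ x = densPos A σ x * Real.exp (-2 * A * x / σ ^ 2) := by
  simp only [densPos, densNeg, gaussianPDFReal, Real.coe_toNNReal _ (sq_nonneg σ)]
  rw [mul_assoc (√_)⁻¹, ← Real.exp_add]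
  congr 2
  field_simp
  ring

theorem bias_eq_posterior_sub (hσ : 0 < σ) (x : ℝ) :
    bias A σ x = posterior A σ 0 x - posterior A σ 1 x := by
  have h := densPos_pos (A := A) hσ x
  have he := Real.exp_pos (-2 * A * x / σ ^ 2)
  simp only [posterior, dens, if_true, one_ne_zero, if_false, densNeg_eq hσ, bias]
  have : densPos A σ x + densPos A σ x * Real.exp (-2 * A * x / σ ^ 2) ≠ 0 := by positivity
  field_simp

theorem abs_bias_le (hσ : 0 < σ) (x : ℝ) : |bias A σ x| ≤ 1 := by
  have h0 := posterior_nonneg (A := A) hσ 0 x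
  have h1 := posterior_nonneg (A := A) hσ 1 x
  have h2 := posterior_add (A := A) hσ x
  rw [bias_eq_posterior_sub hσ, abs_le]
  constructor <;> linarith

theorem bias_zero : bias A σ 0 = 0 := by simp [bias]

theorem bias_pos (hA : 0 < A) (hσ : 0 < σ) {x : ℝ} (hx : 0 < x) : 0 < bias A σ x := by
  have h : Real.exp (-2 * A * x / σ ^ 2) < 1 := by
    rw [Real.exp_lt_one_iff]
    have : 0 < 2 * A * x / σ ^ 2 := by positivity
    have e : -2 * A * x / σ ^ 2 = -(2 * A * x / σ ^ 2) := by ring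
    linarith
  have := Real.exp_pos (-2 * A * x / σ ^ 2)
  unfold bias
  exact div_pos (by linarith) (by linarith)

/-- The decision on the sign of `x`. -/
def hardDecision (x : ℝ) : ℝ := if 0 < x then 1 else if x = 0 then 1 / 2 else 0

/-- The channels of `testChannel` in the parameter `u = exp λ`, completed by the hard decision at
`u = 0`, that is `λ = -∞`. Only `u ≥ 0` is meaningful. -/
def channel (A σ u : ℝ) : ℝ → ℝ :=
  if u = 0 then hardDecision else testChannel A σ (Real.log u)

theorem channel_zero : channel A σ 0 = hardDecision := if_pos rfl

theorem channel_of_ne {u : ℝ} (hu : u ≠ 0) : channel A σ u = testChannel A σ (Real.log u) :=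
  if_neg hu

theorem channel_exp (lam : ℝ) : channel A σ (Real.exp lam) = testChannel A σ lam := by
  rw [channel_of_ne (Real.exp_ne_zero _), Real.log_exp]

theorem channel_one : channel A σ 1 = fun _ => 1 / 2 := by
  ext x
  rw [channel_of_ne one_ne_zero, testChannel_eq]
  norm_num

theorem isChannel_hardDecision : IsChannel hardDecision where
  measurable := by
    unfold hardDecision
    exact Measurable.ite measurableSet_Ioi measurable_const
      (Measurable.ite (measurableSet_singleton 0) measurable_const measurable_const)
  nonneg x := by unfold hardDecision; split_ifs <;> norm_num
  map_neg x := by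
    rcases lt_trichotomy x 0 with h | rfl | h
    · simp [hardDecision, h, h.not_gt, h.ne]
    · norm_num [hardDecision]
    · simp [hardDecision, h, h.not_gt, h.ne']

theorem isChannel_testChannel (lam : ℝ) : IsChannel (testChannel A σ lam) where
  measurable := by
    have : testChannel A σ lam = fun x => (1 + Real.exp (lam * bias A σ x))⁻¹ := rfl
    rw [this]; fun_prop
  nonneg x := by
    have := Real.exp_pos (lam * bias A σ x)
    rw [testChannel_eq]; positivity
  map_neg x := by
    rw [testChannel_eq, testChannel_eq, bias_neg, mul_neg, Real.exp_neg]
    have := Real.exp_pos (lam * bias A σ x)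
    field_simp
    ring

theorem isChannel_channel (u : ℝ) : IsChannel (channel A σ u) := by
  unfold channel; split_ifs
  exacts [isChannel_hardDecision, isChannel_testChannel _]

theorem trans_testChannel_pos (lam : ℝ) (s : Fin 2) (x : ℝ) :
    0 < trans (testChannel A σ lam) s x := by
  have he := Real.exp_pos (lam * bias A σ x)
  fin_cases s
  · change 0 < testChannel A σ lam x
    rw [testChannel_eq]; positivity
  · change 0 < 1 - testChannel A σ lam x
    rw [testChannel_eq, sub_pos]
    exact inv_lt_one_of_one_lt₀ (by linarith)

/-- A test channel with parameter `λ ≤ 0` is optimal at its own distortion level. -/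
theorem info_testChannel_le (hσ : 0 < σ) {lam : ℝ} (hlam : lam ≤ 0) {R : ℝ≥0}
    (h : Achievable (source A σ) hammingDistortion squaredError R
      (ENNReal.ofReal (semDist A σ (testChannel A σ lam))) ∞) :
    info A σ (testChannel A σ lam) ≤ R * Real.log 2 := by
  have hg := isChannel_testChannel (A := A) (σ := σ) lam
  have hpos := trans_testChannel_pos (A := A) (σ := σ) lam
  refine hg.info_le_of_achievable hσ hpos (s := -lam)
    (C := Real.log 2 + Real.log (1 + Real.exp (-lam)) + -lam) (neg_nonneg.mpr hlam)
    (ψ := fun x => Real.log (2 * trans (testChannel A σ lam) 0 x) + -lam * errProb A σ 0 x)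
    ?_ (fun x => ?_) (fun t x => ?_) h
  · have := hg.measurable_trans 0
    fun_prop
  · have hb := abs_le.mp (abs_bias_le (A := A) hσ x)
    have he := Real.exp_pos (lam * bias A σ x)
    have h1 : lam * bias A σ x ≤ -lam := by nlinarith
    have h2 : Real.log (1 + Real.exp (lam * bias A σ x)) ≤ Real.log (1 + Real.exp (-lam)) :=
      Real.log_le_log (by positivity) (by gcongr)
    have h3 : 0 ≤ Real.log (1 + Real.exp (lam * bias A σ x)) := Real.log_nonneg (by linarith)
    have h4 : 0 < Real.log 2 := Real.log_pos one_lt_two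
    have h5 := errProb_nonneg (A := A) hσ 0 x
    have h6 := errProb_le_one (A := A) hσ 0 x
    have h7 : 0 ≤ -lam * errProb A σ 0 x := mul_nonneg (by linarith) h5
    have h8 : -lam * errProb A σ 0 x ≤ -lam := by nlinarith
    rw [trans_zero, testChannel_eq, Real.log_mul two_ne_zero (by positivity), Real.log_inv, abs_le]
    constructor <;> linarith
  · have he := Real.exp_pos (lam * bias A σ x)
    fin_cases t
    · change Real.log (2 * trans _ 0 x) = _ - -lam * errProb A σ 0 x
      ring
    · change Real.log (2 * trans _ 1 x) = _ - -lam * errProb A σ 1 x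
      have e : trans (testChannel A σ lam) 1 x =
          Real.exp (lam * bias A σ x) * trans (testChannel A σ lam) 0 x := by
        rw [trans_one, trans_zero, testChannel_eq]
        field_simp
        ring
      have h0 := hpos 0 x
      rw [e, mul_left_comm, Real.log_mul he.ne' (by positivity), Real.log_exp,
        bias_eq_posterior_sub hσ, errProb_zero, errProb_one]
      ring

/-! ### Dependence on the parameter -/

theorem continuousOn_channel (hA : 0 < A) (hσ : 0 < σ) (x : ℝ) :
    ContinuousOn (fun u => channel A σ u x) (Ici 0) := by
  intro u hu
  rcases (mem_Ici.mp hu).eq_or_lt with rfl | hu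
  · rw [← continuousWithinAt_Ioi_iff_Ici]
    have hlog := Real.tendsto_log_nhdsGT_zero
    have hev : ∀ᶠ u : ℝ in 𝓝[>] 0,
        (1 + Real.exp (Real.log u * bias A σ x))⁻¹ = channel A σ u x := by
      filter_upwards [self_mem_nhdsWithin] with u hu
      rw [channel_of_ne (ne_of_gt hu), testChannel_eq]
    refine Tendsto.congr' hev ?_
    change Tendsto _ _ (𝓝 (channel A σ 0 x))
    rw [channel_zero]
    rcases lt_trichotomy x 0 with hx | rfl | hx
    · have hb : bias A σ x < 0 := by
        have := bias_pos hA hσ (neg_pos.mpr hx)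
        rw [bias_neg] at this; linarith
      have h1 := Real.tendsto_exp_atTop.comp (hlog.atBot_mul_const_of_neg hb)
      have h2 := (tendsto_atTop_add_const_left _ (1 : ℝ) h1).inv_tendsto_atTop
      simp only [hardDecision, hx.not_gt, hx.ne, if_false]
      exact h2
    · simp only [bias_zero, mul_zero, Real.exp_zero, hardDecision]
      norm_num
    · have hb := bias_pos hA hσ hx
      have h1 := Real.tendsto_exp_atBot.comp (hlog.atBot_mul_const hb)
      have h2 := (h1.const_add 1).inv₀ (by norm_num)
      simpa [hardDecision, hx] using h2
  · refine ContinuousAt.continuousWithinAt ?_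
    have hev : ∀ᶠ v : ℝ in 𝓝 u, (1 + Real.exp (Real.log v * bias A σ x))⁻¹ = channel A σ v x := by
      filter_upwards [eventually_ne_nhds hu.ne'] with v hv
      rw [channel_of_ne hv, testChannel_eq]
    refine ContinuousAt.congr ?_ hev
    have : ContinuousAt Real.log u := Real.continuousAt_log hu.ne'
    have he := Real.exp_pos (Real.log u * bias A σ x)
    refine ContinuousAt.inv₀ (by fun_prop) (by positivity)

theorem continuousOn_integral_mul_channel (hA : 0 < A) (hσ : 0 < σ) {h : ℝ → ℝ}
    (hh : Integrable h (mixLaw A σ)) :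
    ContinuousOn (fun u => ∫ x, h x * channel A σ u x ∂mixLaw A σ) (Ici 0) := by
  refine continuousOn_of_dominated (bound := fun x => ‖h x‖) (fun u _ => ?_) (fun u _ => ?_)
    hh.norm ?_
  · exact hh.1.mul (isChannel_channel u).measurable.aestronglyMeasurable
  · refine Eventually.of_forall fun x => ?_
    rw [norm_mul, Real.norm_of_nonneg ((isChannel_channel u).nonneg x)]
    exact mul_le_of_le_one_right (norm_nonneg _) ((isChannel_channel u).le_one x)
  · exact Eventually.of_forall fun x => continuousOn_const.mul (continuousOn_channel hA hσ x)

theorem integrable_bias (hσ : 0 < σ) : Integrable (bias A σ) (mixLaw A σ) :=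
  Integrable.of_bound measurable_bias.aestronglyMeasurable 1
    (Eventually.of_forall fun x => abs_bias_le hσ x)

theorem integrable_mul_channel {h : ℝ → ℝ} (hh : Integrable h (mixLaw A σ)) (u : ℝ) :
    Integrable (fun x => h x * channel A σ u x) (mixLaw A σ) := by
  have := (isChannel_channel (A := A) (σ := σ) u).integrable_mul 0 hh
  simpa only [trans_zero, mul_comm] using this

theorem semDist_eq_integral_bias (hσ : 0 < σ) (g : ℝ → ℝ) :
    semDist A σ g = (1 - 2 * ∫ x, bias A σ x * g x ∂mixLaw A σ) / 2 := by
  rw [integral_mixLaw hσ, ← integral_const_mul, semDist]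
  congr 3
  ext x
  have h0 := mixDens_mul_posterior (A := A) hσ 0 x
  have h1 := mixDens_mul_posterior (A := A) hσ 1 x
  simp only [dens, if_true, one_ne_zero, if_false] at h0 h1
  rw [bias_eq_posterior_sub hσ]
  linear_combination (-2 * g x) * h0 + (2 * g x) * h1

theorem continuousOn_semDist (hA : 0 < A) (hσ : 0 < σ) :
    ContinuousOn (fun u => semDist A σ (channel A σ u)) (Ici 0) := by
  simp only [semDist_eq_integral_bias hσ]
  exact (continuousOn_const.sub (continuousOn_const.mul
    (continuousOn_integral_mul_channel hA hσ (integrable_bias hσ)))).div_const 2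

theorem condMean_eq (hσ : 0 < σ) (g : ℝ → ℝ) :
    condMean A σ g = 2 * ∫ x, x * g x ∂mixLaw A σ := by
  rw [integral_mixLaw hσ, ← integral_const_mul, condMean]
  congr 1
  ext x
  rw [mixDens]; ring

theorem condVar_channel_eq (hσ : 0 < σ) (u : ℝ) :
    condVar A σ (channel A σ u) = 2 * (∫ x, x ^ 2 * channel A σ u x ∂mixLaw A σ -
      2 * condMean A σ (channel A σ u) * ∫ x, x * channel A σ u x ∂mixLaw A σ +
      condMean A σ (channel A σ u) ^ 2 * ∫ x, 1 * channel A σ u x ∂mixLaw A σ) := by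
  set γ := condMean A σ (channel A σ u) with hγ
  have h0 := integrable_mul_channel (integrable_const (μ := mixLaw A σ) (1 : ℝ)) u
  have h1 := integrable_mul_channel (A := A) (σ := σ) (by simpa using integrable_pow_mixLaw 1 :
    Integrable (fun x => x) (mixLaw A σ)) u
  have h2 := integrable_mul_channel (integrable_pow_mixLaw (A := A) (σ := σ) 2) u
  have e1 := integral_add (h2.sub (h1.const_mul (2 * γ))) (h0.const_mul (γ ^ 2))
  have e2 := integral_sub h2 (h1.const_mul (2 * γ))
  rw [integral_const_mul] at e1 e2
  simp only [Pi.sub_apply] at e1 e2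
  rw [← e2, ← e1, integral_mixLaw hσ, ← integral_const_mul, condVar]
  congr 1
  ext x
  rw [mixDens]; ring

theorem continuousOn_condVar (hA : 0 < A) (hσ : 0 < σ) :
    ContinuousOn (fun u => condVar A σ (channel A σ u)) (Ici 0) := by
  have h0 := continuousOn_integral_mul_channel hA hσ (integrable_const (μ := mixLaw A σ) (1 : ℝ))
  have h1 := continuousOn_integral_mul_channel hA hσ (by simpa using integrable_pow_mixLaw 1 :
    Integrable (fun x => x) (mixLaw A σ))
  have h2 := continuousOn_integral_mul_channel hA hσ (integrable_pow_mixLaw (A := A) (σ := σ) 2)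
  simp only [condVar_channel_eq hσ, condMean_eq hσ]
  exact continuousOn_const.mul ((h2.sub ((continuousOn_const.mul (continuousOn_const.mul h1)).mul
    h1)).add (((continuousOn_const.mul h1).pow 2).mul h0))

theorem continuousOn_info (hA : 0 < A) (hσ : 0 < σ) :
    ContinuousOn (fun u => info A σ (channel A σ u)) (Ici 0) := by
  refine continuousOn_of_dominated (bound := fun _ => 2) (fun u _ => ?_) (fun u _ => ?_)
    (integrable_const _) ?_
  · have hm := (isChannel_channel (A := A) (σ := σ) u).measurable_trans
    exact (Finset.measurable_sum _ fun s _ =>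
      (hm s).mul ((hm s).const_mul 2).log).aestronglyMeasurable
  · refine Eventually.of_forall fun x => ?_
    have hg := isChannel_channel (A := A) (σ := σ) u
    have h := fun s => abs_mul_log_two_mul_le (hg.trans_nonneg s x) (hg.trans_le_one s x)
    rw [Fin.sum_univ_two, Real.norm_eq_abs]
    exact (abs_add_le _ _).trans (by linarith [h 0, h 1])
  · refine Eventually.of_forall fun x => ?_
    have hc := continuousOn_channel hA hσ x
    have hl : Continuous fun t : ℝ => t * Real.log (2 * t) := by
      have := (Real.continuous_mul_log.comp (continuous_const_mul (2 : ℝ))).div_const 2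
      refine this.congr fun t => ?_
      simp only [Function.comp]
      ring
    simp only [Fin.sum_univ_two, trans_zero, trans_one]
    exact (hl.comp_continuousOn hc).add (hl.comp_continuousOn (continuousOn_const.sub hc))

theorem channel_lt (hA : 0 < A) (hσ : 0 < σ) {u v x : ℝ} (hu : 0 ≤ u) (huv : u < v) (hx : 0 < x) :
    channel A σ v x < channel A σ u x := by
  have hb := bias_pos hA hσ hx
  have hv : 0 < v := hu.trans_lt huv
  have he := Real.exp_pos (Real.log v * bias A σ x)
  rw [channel_of_ne hv.ne', testChannel_eq]
  rcases hu.eq_or_lt with rfl | hu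
  · rw [channel_zero, hardDecision, if_pos hx]
    exact inv_lt_one_of_one_lt₀ (by linarith)
  · rw [channel_of_ne hu.ne', testChannel_eq]
    have := Real.exp_pos (Real.log u * bias A σ x)
    have hl := Real.log_lt_log hu huv
    gcongr

theorem mixLaw_singleton (hσ : 0 < σ) (x : ℝ) : mixLaw A σ {x} = 0 := by
  rw [mixLaw_eq_withDensity hσ]
  exact withDensity_absolutelyContinuous _ _ (by simp)

/-- The distortion is a strictly increasing function of the parameter. -/
theorem strictMonoOn_semDist (hA : 0 < A) (hσ : 0 < σ) :
    StrictMonoOn (fun u => semDist A σ (channel A σ u)) (Ici 0) := by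
  intro u hu v hv huv
  simp only [semDist_eq_integral_bias hσ]
  have hlt : ∀ x, x ≠ 0 → bias A σ x * channel A σ v x < bias A σ x * channel A σ u x := by
    intro x hx
    rcases hx.lt_or_gt with hx | hx
    · have h1 := mul_lt_mul_of_pos_left (channel_lt hA hσ hu huv (neg_pos.mpr hx))
        (bias_pos hA hσ (neg_pos.mpr hx))
      rw [(isChannel_channel u).map_neg, (isChannel_channel v).map_neg, bias_neg] at h1
      linarith
    · exact mul_lt_mul_of_pos_left (channel_lt hA hσ hu huv hx) (bias_pos hA hσ hx)
  have hu' := integrable_mul_channel (integrable_bias (A := A) hσ) u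
  have hv' := integrable_mul_channel (integrable_bias (A := A) hσ) v
  have hsupp : Function.support
      (fun x => bias A σ x * channel A σ u x - bias A σ x * channel A σ v x) = {0}ᶜ := by
    ext x
    rw [Function.mem_support, mem_compl_iff, mem_singleton_iff]
    refine ⟨fun h hx => h ?_, fun h => (sub_pos.mpr (hlt x h)).ne'⟩
    rw [hx, bias_zero]; ring
  have hpos : 0 < ∫ x, (bias A σ x * channel A σ u x - bias A σ x * channel A σ v x)
      ∂mixLaw A σ := by
    have hi : Integrable (fun x => bias A σ x * channel A σ u x - bias A σ x * channel A σ v x)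
        (mixLaw A σ) := hu'.sub hv'
    rw [integral_pos_iff_support_of_nonneg (fun x => ?_) hi, hsupp,
      (prob_compl_eq_one_iff (measurableSet_singleton 0)).mpr (mixLaw_singleton hσ 0)]
    · exact one_pos
    · by_cases hx : x = 0
      · simp [hx, bias_zero]
      · exact (sub_pos.mpr (hlt x hx)).le
  rw [integral_sub hu' hv'] at hpos
  linarith

theorem semDist_channel_one (hσ : 0 < σ) : semDist A σ (channel A σ 1) = 1 / 2 := by
  rw [semDist, channel_one, integral_mul_const, integral_sub integrable_densPos integrable_densNeg,
    integral_densPos hσ, integral_densNeg hσ]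
  norm_num

theorem IsChannel.semDist_eq_integral_densNeg (hσ : 0 < σ) {g : ℝ → ℝ} (hg : IsChannel g) :
    semDist A σ g = ∫ x, densNeg A σ x * g x := by
  have hi : ∀ {f : ℝ → ℝ}, Integrable f → Integrable fun x => f x * g x := fun {f} hf => by
    have := hg.integrable_mul 0 hf
    simpa only [trans_zero, mul_comm] using this
  have h1 := hi (integrable_densPos (A := A) (σ := σ))
  have h2 := hi (integrable_densNeg (A := A) (σ := σ))
  have e : ∫ x, densPos A σ x * g x = 1 - ∫ x, densNeg A σ x * g x := by
    rw [← integral_neg_eq_self]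
    simp only [densPos_neg, hg.map_neg, mul_sub, mul_one]
    rw [integral_sub integrable_densNeg h2, integral_densNeg hσ]
  rw [semDist]
  simp only [sub_mul]
  rw [integral_sub h1 h2, e]
  ring

theorem semDist_hardDecision (hσ : 0 < σ) : semDist A σ hardDecision = gaussianQ (A / σ) := by
  have h1 : ∫ x, densNeg A σ x * hardDecision x = ∫ x in Ioi 0, densNeg A σ x := by
    rw [← integral_indicator measurableSet_Ioi]
    refine integral_congr_ae ?_
    filter_upwards [(measure_eq_zero_iff_ae_notMem.mp (Real.volume_singleton (a := 0)))] with x hx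
    have hx : x ≠ 0 := hx
    by_cases h : 0 < x <;> simp [hardDecision, h, hx]
  have hmap : (gaussianReal 0 1).map (fun x => σ * x + -A) =
      gaussianReal (-A) (σ ^ 2).toNNReal := by
    have e : (fun x => σ * x + -A) = (fun x => x + -A) ∘ fun x => σ * x := rfl
    rw [e, ← Measure.map_map (by fun_prop) (by fun_prop), gaussianReal_map_const_mul,
      gaussianReal_map_add_const, mul_zero, zero_add, mul_one]
    congr 1
    ext
    simp [Real.coe_toNNReal _ (sq_nonneg σ)]
  rw [isChannel_hardDecision.semDist_eq_integral_densNeg hσ, h1, gaussianQ]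
  have h2 : (gaussianReal (-A) (σ ^ 2).toNNReal).real (Ioi 0) = ∫ x in Ioi 0, densNeg A σ x := by
    rw [measureReal_def, gaussianReal_apply_eq_integral _ (variance_ne_zero hσ),
      ENNReal.toReal_ofReal (integral_nonneg fun x => gaussianPDFReal_nonneg _ _ _)]
    rfl
  rw [← h2, ← hmap, map_measureReal_apply (by fun_prop) measurableSet_Ioi]
  congr 1
  ext x
  simp only [mem_preimage, mem_Ioi]
  rw [div_lt_iff₀ hσ]
  constructor <;> intro h <;> linarith

theorem semDist_channel_zero (hσ : 0 < σ) : semDist A σ (channel A σ 0) = gaussianQ (A / σ) := by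
  rw [channel_zero, semDist_hardDecision hσ]

theorem gaussianQ_zero_div (hσ : 0 < σ) : gaussianQ (0 / σ) = 1 / 2 := by
  rw [← semDist_hardDecision hσ, semDist]
  simp [densPos, densNeg]

theorem isParameter_iff {D lam : ℝ} :
    IsParameter A σ D lam ↔ lam < 0 ∧ semDist A σ (testChannel A σ lam) = D := by
  rw [IsParameter, semDist]
  refine and_congr_right fun _ => ?_
  constructor <;> intro h <;> linarith

theorem exists_channel (hA : 0 < A) (hσ : 0 < σ) {D : ℝ}
    (hD : D ∈ Icc (gaussianQ (A / σ)) (1 / 2)) :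
    ∃ u ∈ Icc (0 : ℝ) 1, semDist A σ (channel A σ u) = D := by
  have h := intermediate_value_Icc (zero_le_one (α := ℝ))
    ((continuousOn_semDist hA hσ).mono Icc_subset_Ici_self)
  rw [semDist_channel_zero hσ, semDist_channel_one hσ] at h
  exact h hD

theorem existsUnique_isParameter (hA : 0 ≤ A) (hσ : 0 < σ) {D : ℝ}
    (hD : D ∈ Ioo (gaussianQ (A / σ)) (1 / 2)) : ∃! lam, IsParameter A σ D lam := by
  have hA : 0 < A := by
    refine lt_of_le_of_ne hA fun h => ?_
    rw [← h, gaussianQ_zero_div hσ] at hD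
    exact lt_irrefl _ (hD.1.trans hD.2)
  obtain ⟨u, hu, huD⟩ := exists_channel hA hσ ⟨hD.1.le, hD.2.le⟩
  have hu0 : 0 < u := by
    refine lt_of_le_of_ne hu.1 fun h => ?_
    rw [← h, semDist_channel_zero hσ] at huD
    exact hD.1.ne huD
  have hu1 : u < 1 := by
    refine lt_of_le_of_ne hu.2 fun h => ?_
    rw [h, semDist_channel_one hσ] at huD
    exact hD.2.ne huD.symm
  refine ⟨Real.log u, isParameter_iff.mpr ⟨Real.log_neg hu0 hu1, ?_⟩, fun lam hlam => ?_⟩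
  · rwa [← channel_of_ne hu0.ne']
  · obtain ⟨-, h⟩ := isParameter_iff.mp hlam
    rw [← channel_exp] at h
    have := (strictMonoOn_semDist hA hσ).injOn (mem_Ici.mpr (Real.exp_pos lam).le)
      (mem_Ici.mpr hu.1) (h.trans huD.symm)
    rw [← this, Real.log_exp]

theorem optimalChannel_of_ge {D : ℝ} (hD : 1 / 2 ≤ D) :
    optimalChannel A σ D = channel A σ 1 := by
  rw [optimalChannel, if_pos hD, channel_one]

theorem optimalChannel_semDist (hA : 0 < A) (hσ : 0 < σ) {u : ℝ} (hu : u ∈ Icc (0 : ℝ) 1) :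
    optimalChannel A σ (semDist A σ (channel A σ u)) = channel A σ u := by
  have hmono := strictMonoOn_semDist hA hσ
  rcases hu.2.eq_or_lt with rfl | hu1
  · exact optimalChannel_of_ge (semDist_channel_one hσ).ge
  have h1 := hmono (mem_Ici.mpr hu.1) (mem_Ici.mpr zero_le_one) hu1
  simp only [semDist_channel_one hσ] at h1
  rw [optimalChannel, if_neg (not_le.mpr h1)]
  rcases hu.1.eq_or_lt with rfl | hu0
  · rw [if_pos (semDist_channel_zero hσ).le, channel_zero]
    rfl
  have h0 := hmono (mem_Ici.mpr le_rfl) (mem_Ici.mpr hu.1) hu0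
  simp only [semDist_channel_zero hσ] at h0
  rw [if_neg (not_le.mpr h0)]
  have huniq := existsUnique_isParameter hA.le hσ (D := semDist A σ (channel A σ u)) ⟨h0, h1⟩
  have hp : IsParameter A σ (semDist A σ (channel A σ u))
      (parameter A σ (semDist A σ (channel A σ u))) := Classical.epsilon_spec huniq.exists
  have hl : IsParameter A σ (semDist A σ (channel A σ u)) (Real.log u) :=
    isParameter_iff.mpr ⟨Real.log_neg hu0 hu1, by rw [← channel_of_ne hu0.ne']⟩
  rw [huniq.unique hp hl, channel_of_ne hu0.ne']

/-! ### The two-stage rate -/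

theorem IsChannel.sordf_top_le (hσ : 0 < σ) {g : ℝ → ℝ} (hg : IsChannel g) :
    sordf A σ (ENNReal.ofReal (semDist A σ g)) ∞ ≤
      ENNReal.ofReal (info A σ g / Real.log 2) := by
  have hD : 0 < max (condVar A σ g) 1 := lt_max_of_lt_right one_pos
  refine (sordf_anti le_rfl le_top).trans ((hg.sordf_le hσ hD).trans (le_of_eq ?_))
  rw [max_eq_right (Real.logb_nonpos one_lt_two (div_nonneg (hg.condVar_nonneg hσ) hD.le)
    ((div_le_one hD).mpr (le_max_left _ _)))]
  simp

/-- The channels of the family lie on the curve of the semantic rate-distortion function. -/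
theorem sordf_channel_top (hA : 0 < A) (hσ : 0 < σ) {u : ℝ} (hu : u ∈ Icc (0 : ℝ) 1) :
    sordf A σ (ENNReal.ofReal (semDist A σ (channel A σ u))) ∞ =
      ENNReal.ofReal (info A σ (channel A σ u) / Real.log 2) := by
  have hl : 0 < Real.log 2 := Real.log_pos one_lt_two
  refine le_antisymm ((isChannel_channel u).sordf_top_le hσ) (le_iInf₂ fun R hR => ?_)
  rw [← ENNReal.ofReal_coe_nnreal]
  refine ENNReal.ofReal_le_ofReal ((div_le_iff₀ hl).mpr ?_)
  have hpos : ∀ v : ℝ, u ≤ v → 0 < v → v ≤ 1 → info A σ (channel A σ v) ≤ R * Real.log 2 := by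
    intro v huv hv0 hv1
    have hmono := (strictMonoOn_semDist hA hσ).monotoneOn (mem_Ici.mpr hu.1)
      (mem_Ici.mpr hv0.le) huv
    have hR' := hR.mono (ENNReal.ofReal_le_ofReal hmono) le_rfl
    simp only [channel_of_ne hv0.ne'] at hR' ⊢
    exact info_testChannel_le hσ (Real.log_nonpos hv0.le hv1) hR'
  rcases hu.1.eq_or_lt with rfl | hu0
  · have hc : Tendsto (fun v => info A σ (channel A σ v)) (𝓝[>] 0)
        (𝓝 (info A σ (channel A σ 0))) :=
      ((continuousOn_info hA hσ) 0 (mem_Ici.mpr le_rfl)).mono_left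
        (nhdsWithin_mono _ Ioi_subset_Ici_self)
    refine le_of_tendsto hc ?_
    filter_upwards [Ioc_mem_nhdsGT (zero_lt_one' ℝ)] with v hv
    exact hpos v hv.1.le hv.1 hv.2
  · exact hpos u le_rfl hu0 hu.2

theorem info_channel_one : info A σ (channel A σ 1) = 0 := by
  simp only [info, channel_one, Fin.sum_univ_two, trans_zero, trans_one]
  norm_num

theorem sordf_top_of_ge (hσ : 0 < σ) {D : ℝ} (hD : 1 / 2 ≤ D) :
    sordf A σ (ENNReal.ofReal D) ∞ = 0 := by
  have h := (isChannel_channel (A := A) (σ := σ) 1).sordf_top_le (A := A) hσ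
  rw [semDist_channel_one hσ, info_channel_one, zero_div, ENNReal.ofReal_zero] at h
  exact le_antisymm ((sordf_anti (ENNReal.ofReal_le_ofReal hD) le_rfl).trans h) zero_le

/-- The two-stage rate as a function of the channel parameter. -/
def channelRate (A σ Da u : ℝ) : ℝ≥0∞ :=
  ENNReal.ofReal (info A σ (channel A σ u) / Real.log 2) +
    ENNReal.ofReal (1 / 2 * max (Real.logb 2 (condVar A σ (channel A σ u) / Da)) 0)

theorem eta_eq (D : ℝ) : eta A σ D = condVar A σ (optimalChannel A σ D) := rfl

theorem twoStageRate_of_ge (hσ : 0 < σ) {Da D : ℝ} (hD : 1 / 2 ≤ D) :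
    twoStageRate A σ Da D = channelRate A σ Da 1 := by
  rw [twoStageRate, channelRate, sordf_top_of_ge hσ hD, eta_eq, optimalChannel_of_ge hD,
    info_channel_one, zero_div, ENNReal.ofReal_zero]

theorem twoStageRate_semDist (hA : 0 < A) (hσ : 0 < σ) {Da u : ℝ} (hu : u ∈ Icc (0 : ℝ) 1) :
    twoStageRate A σ Da (semDist A σ (channel A σ u)) = channelRate A σ Da u := by
  rw [twoStageRate, channelRate, sordf_channel_top hA hσ hu, eta_eq,
    optimalChannel_semDist hA hσ hu]

theorem continuousOn_channelRate (hA : 0 < A) (hσ : 0 < σ) {Da : ℝ} (hDa : 0 < Da) :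
    ContinuousOn (channelRate A σ Da) (Ici 0) := by
  have h1 := (continuousOn_info hA hσ).div_const (Real.log 2)
  have h2 : ContinuousOn (fun u => 1 / 2 *
      max (Real.logb 2 (condVar A σ (channel A σ u) / Da)) 0) (Ici 0) := by
    have e : ∀ u, max (Real.logb 2 (condVar A σ (channel A σ u) / Da)) 0 =
        Real.log (max (condVar A σ (channel A σ u)) Da / Da) / Real.log 2 := fun u =>
      (logb_max_div ((isChannel_channel u).condVar_nonneg hσ) hDa).symm
    simp only [e]
    refine continuousOn_const.mul (ContinuousOn.div_const (ContinuousOn.log ?_ fun u _ => ?_) _)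
    · exact ((continuousOn_condVar hA hσ).sup continuousOn_const).div_const Da
    · have : 0 < max (condVar A σ (channel A σ u)) Da := lt_max_of_lt_right hDa
      positivity
  exact (ENNReal.continuous_ofReal.comp_continuousOn h1).add
    (ENNReal.continuous_ofReal.comp_continuousOn h2)

theorem sordf_le_channelRate (hσ : 0 < σ) {Ds Da u : ℝ} (hDa : 0 < Da)
    (hu : semDist A σ (channel A σ u) ≤ Ds) :
    sordf A σ (ENNReal.ofReal Ds) (ENNReal.ofReal Da) ≤ channelRate A σ Da u :=
  (sordf_anti (ENNReal.ofReal_le_ofReal hu) le_rfl).trans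
    (((isChannel_channel u).sordf_le hσ hDa).trans ENNReal.ofReal_add_le)

/-- The parameters of the channels that respect the semantic level `Ds` form a compact set, on
which the continuous two-stage rate attains its minimum. -/
theorem exists_isMinOn_twoStageRate (hA : 0 < A) (hσ : 0 < σ) {Ds Da : ℝ}
    (hDs : gaussianQ (A / σ) ≤ Ds) (hDa : 0 < Da) :
    ∃ D₀ ∈ Icc (gaussianQ (A / σ)) Ds,
      IsMinOn (twoStageRate A σ Da) (Icc (gaussianQ (A / σ)) Ds) D₀ ∧
      sordf A σ (ENNReal.ofReal Ds) (ENNReal.ofReal Da) ≤ twoStageRate A σ Da D₀ := by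
  have hsub : Icc (0 : ℝ) 1 ⊆ Ici 0 := Icc_subset_Ici_self
  set K := Icc (0 : ℝ) 1 ∩ (fun u => semDist A σ (channel A σ u)) ⁻¹' Iic Ds with hK
  have hKc : IsCompact K := isCompact_Icc.of_isClosed_subset
    (((continuousOn_semDist hA hσ).mono hsub).preimage_isClosed_of_isClosed isClosed_Icc
      isClosed_Iic) inter_subset_left
  have hKne : K.Nonempty := ⟨0, ⟨le_rfl, zero_le_one⟩, by
    change semDist A σ (channel A σ 0) ≤ Ds
    rwa [semDist_channel_zero hσ]⟩
  obtain ⟨u₀, hu₀, hmin⟩ := hKc.exists_isMinOn hKne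
    ((continuousOn_channelRate hA hσ hDa).mono (inter_subset_left.trans hsub))
  have hQ : gaussianQ (A / σ) ≤ semDist A σ (channel A σ u₀) := by
    rw [← semDist_channel_zero hσ]
    exact (strictMonoOn_semDist hA hσ).monotoneOn (mem_Ici.mpr le_rfl) (hsub hu₀.1) hu₀.1.1
  refine ⟨semDist A σ (channel A σ u₀), ⟨hQ, hu₀.2⟩, fun D hD => ?_, ?_⟩
  · change twoStageRate A σ Da _ ≤ twoStageRate A σ Da D
    rw [twoStageRate_semDist hA hσ hu₀.1]
    rcases le_total (1 / 2) D with h | h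
    · rw [twoStageRate_of_ge hσ h]
      refine hmin ⟨⟨zero_le_one, le_rfl⟩, ?_⟩
      change semDist A σ (channel A σ 1) ≤ Ds
      rw [semDist_channel_one hσ]
      exact h.trans hD.2
    · obtain ⟨u, hu, rfl⟩ := exists_channel hA hσ ⟨hD.1, h⟩
      rw [twoStageRate_semDist hA hσ hu]
      exact hmin ⟨hu, hD.2⟩
  · rw [twoStageRate_semDist hA hσ hu₀.1]
    exact sordf_le_channelRate hσ hDa hu₀.2

end

end SemanticRD

theorem mainTheorem7 (A σ Ds Da : ℝ) (hA : 0 ≤ A) (hσ : 0 < σ)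
    (hDs : gaussianQ (A / σ) ≤ Ds) (hDa : 0 < Da) :
    (∀ D ∈ Ioo (gaussianQ (A / σ)) (1 / 2), ∃! lam : ℝ, IsParameter A σ D lam) ∧
    ∃ D₀ ∈ Icc (gaussianQ (A / σ)) Ds,
      IsMinOn (twoStageRate A σ Da) (Icc (gaussianQ (A / σ)) Ds) D₀ ∧
      sordf A σ (ENNReal.ofReal Ds) (ENNReal.ofReal Da) ≤ twoStageRate A σ Da D₀ := by
  refine ⟨fun D hD => existsUnique_isParameter hA hσ hD, ?_⟩
  rcases hA.eq_or_lt with rfl | hA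
  · -- without separation of the means, `Q(0) = 1/2` and the two-stage rate is constant
    rw [gaussianQ_zero_div hσ] at hDs ⊢
    refine ⟨1 / 2, ⟨le_rfl, hDs⟩, fun D hD => ?_, ?_⟩
    · change twoStageRate 0 σ Da (1 / 2) ≤ twoStageRate 0 σ Da D
      rw [twoStageRate_of_ge hσ le_rfl, twoStageRate_of_ge hσ hD.1]
    · rw [twoStageRate_of_ge hσ le_rfl]
      exact sordf_le_channelRate hσ hDa ((semDist_channel_one hσ).le.trans hDs)
  · exact exists_isMinOn_twoStageRate hA hσ hDs hDa
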